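/- Let $\hat M$ be a complete connected smooth Riemannian manifold of dimension $n$ with Riemannian distance $d$, let $M\subset\hat M$ be compact, and let $m$ be a Borel probability measure on $\hat M$ with support $M$ that is absolutely continuous with respect to the Riemannian volume measure. For $u:M\to\mathbb{R}$ put $$u^{\mathfrak c}(x)=-\inf_{y\in M}\Big[\tfrac12 d^2(x,y)+u(y)\Big],\qquad x\in M,$$ and let $\mathcal K$ be the set of $d^2/2$-convex functions on $M$, that is, of the functions $\varphi:M\to\mathbb{R}$ such that $\varphi=\psi^{\mathfrak c}$ for some $\psi:M\to\mathbb{R}$ (the infimum being finite for all $x\in M$). For a function $u$ on $M$ that is differentiable (along $M$) $m$-almost everywhere, with gradient $\nabla u$, let $$\|u\|_{H^1}=\Big[\int_M|\nabla u|^2\,dm+\int_M u^2\,dm\Big]^{1/2}.$$ Then every $\varphi\in\mathcal K$ is Lipschitz continuous and differentiable $m$-almost everywhere, $|\nabla\varphi|$ is measurable, and $\|\varphi\|_{H^1}<\infty$; moreover $\varphi\in\mathcal K$ implies $\varphi^{\mathfrak c}\in\mathcal K$, and the conjugation map $$\mathfrak C_{\mathcal K}:\mathcal K\to\mathcal K,\qquad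 \varphi\mapsto\varphi^{\mathfrak c},$$ is continuous with respect to the $H^1$-norm: for every $\varphi\in\mathcal K$ and $\varepsilon>0$ there is $\delta>0$ such that $\|\psi^{\mathfrak c}-\varphi^{\mathfrak c}\|_{H^1}<\varepsilon$ for all $\psi\in\mathcal K$ with $\|\psi-\varphi\|_{H^1}<\delta$. -/

import Mathlib

open MeasureTheory Bundle
open scoped Manifold ContDiff ENNReal Bundle

noncomputable section

namespace ConjugationMap

section Convexity

variable {N : Type*} [MetricSpace N]

/-- The generalized Legendre transform `u^c(x) = -inf_{y ∈ M} [d(x,y)²/2 + u(y)]` of a function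
on the subset `M`, with respect to the distance of the ambient space. -/
def conj (M : Set N) (u : M → ℝ) : M → ℝ :=
  fun x ↦ -⨅ y : M, ((dist (x : N) (y : N)) ^ 2 / 2 + u y)

/-- The set `𝒦(M)` of `d²/2`-convex functions `φ : M → ℝ`: there is `ψ : M → ℝ` such that, for
every `x ∈ M`, the infimum of `d(x,y)²/2 + ψ(y)` over `y ∈ M` is finite and equal to `-φ(x)`. -/
def convexFunctions (M : Set N) : Set (M → ℝ) :=
  {φ | ∃ ψ : M → ℝ, ∀ x : M,
    IsGLB (Set.range fun y : M ↦ (dist (x : N) (y : N)) ^ 2 / 2 + ψ y) (-φ x)}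

end Convexity

section Riemannian

variable {n : ℕ} {N : Type*} [MetricSpace N] [ChartedSpace (EuclideanSpace ℝ (Fin n)) N]
  [RiemannianBundle (fun x : N ↦ TangentSpace (𝓡 n) x)]

/-- The matrix `g_{ij}` of the Riemannian metric in the chart `e`, at the point with coordinates
`y`: the inner products of the coordinate vector fields. -/
def metricMatrix (e : OpenPartialHomeomorph N (EuclideanSpace ℝ (Fin n)))
    (y : EuclideanSpace ℝ (Fin n)) : Matrix (Fin n) (Fin n) ℝ :=
  let v : Fin n → TangentSpace (𝓡 n) (e.symm y) := fun i ↦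
    mfderiv (𝓡 n) (𝓡 n) e.symm y (EuclideanSpace.single i (1 : ℝ) : EuclideanSpace ℝ (Fin n))
  Matrix.of fun i j ↦ inner ℝ (v i) (v j)

/-- The Riemannian volume of the domain of the chart `e`, that is `√(det g) dy` carried from the
target of `e` to the manifold; it gives no mass to the complement of the domain. -/
def chartVolume [MeasurableSpace N] (e : OpenPartialHomeomorph N (EuclideanSpace ℝ (Fin n))) :
    Measure N :=
  Measure.map e.symm (((volume : Measure (EuclideanSpace ℝ (Fin n))).restrict e.target).withDensity
    fun y ↦ ENNReal.ofReal (√(metricMatrix e y).det))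

variable (n N) in
/-- The Riemannian volume measure: the smallest measure that dominates `√(det g) dy` on the domain
of every chart of the atlas. As these measures agree on overlaps, it restricts to `√(det g) dy` on
each of these domains. -/
def riemannianVolume [MeasurableSpace N] : Measure N :=
  ⨆ e ∈ atlas (EuclideanSpace ℝ (Fin n)) N, chartVolume e

/-- The extension by zero of a function on `M`. Only its values on `M` will matter. -/
def extendZero (M : Set N) (u : M → ℝ) : N → ℝ :=
  Function.extend Subtype.val u 0

variable (n) in
/-- `v` is a gradient at the point `x` of the function `u` on `M`: `u` is differentiable at `x`
along `M`, with differential `⟨v, ·⟩`. -/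
def HasGradAt (M : Set N) (u : M → ℝ) (x : N) (v : TangentSpace (𝓡 n) x) : Prop :=
  HasMFDerivWithinAt (𝓡 n) 𝓘(ℝ, ℝ) (extendZero M u) M x (innerSL ℝ v)

open Classical in
variable (n) in
/-- The gradient `∇u` of a function on `M`, set to zero where `u` is not differentiable. At the
points of density of `M`, the gradient is unique if it exists. -/
def grad (M : Set N) (u : M → ℝ) (x : N) : TangentSpace (𝓡 n) x :=
  if h : ∃ v, HasGradAt n M u x v then h.choose else 0

variable (n) in
/-- The norm `‖u‖_{H¹} = (∫_M |∇u|² dm + ∫_M u² dm)^{1/2}`. -/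
def h1Norm [MeasurableSpace N] (m : Measure N) (M : Set N) (u : M → ℝ) : ℝ≥0∞ :=
  ((∫⁻ x in M, ‖grad n M u x‖ₑ ^ 2 ∂m) + ∫⁻ x in M, ‖extendZero M u x‖ₑ ^ 2 ∂m) ^ (1 / 2 : ℝ)

variable (n) in
/-- `u` is a Lipschitz function on `M` that lies in `H¹(M, m)`: it is differentiable at `m`-almost
every point, the length of its gradient is measurable, and its `H¹` norm is finite. -/
structure IsLipschitzH1 [MeasurableSpace N] (m : Measure N) (M : Set N) (u : M → ℝ) : Prop where
  lipschitz : ∃ C, LipschitzWith C u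
  ae_differentiable : ∀ᵐ x ∂m.restrict M, ∃ v, HasGradAt n M u x v
  aemeasurable : AEMeasurable (fun x ↦ ‖grad n M u x‖ₑ) (m.restrict M)
  h1Norm_lt_top : h1Norm n m M u < ⊤

end Riemannian

end ConjugationMap

end

noncomputable section

namespace ConjugationMap

open Set Filter Metric Manifold
open scoped Topology NNReal

/-! Conjugation is nonexpansive for the sup norm, because an infimum is, and every function of
`𝒦(M)` is Lipschitz with constant `diam M`, because each `d(·,y)²/2` is. For functions with a common
Lipschitz constant, smallness in `L²(m)` forces uniform smallness, since the balls of a given radius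
centred on the compact support have mass bounded below (`exists_forall_abs_le_of_h1Norm_lt`). Hence
`H¹` convergence of `ψ k` to `φ` gives uniform convergence of the conjugates, and only their
gradients remain to be controlled.

The gradients converge by semiconvexity. In a chart, `d(·,y)²` has second differences at most `C
|k|^(4/3)`, uniformly for `y ∈ M` (`ChartBound.exists_secondDiff_le`), so all conjugates have second
differences at least `-C |k|^(4/3)`. An exponent above 1 is all that is needed: for uniformly
semiconvex functions, uniform convergence implies convergence of the derivatives wherever they exist
(`tendsto_fderiv_of_secondDiffGE`). They exist almost everywhere by Rademacher's theorem. Gradients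
of Lipschitz functions are bounded in terms of the Lipschitz constant (`exists_grad_bound`), and
dominated convergence concludes.

The exponent 4/3 makes minimizing geodesics and the exponential map unnecessary. For `|k| ≤ s³`,
take a point `z` at the fraction `s²` of an almost minimizing path to `y`. Near the base point the
metric is constant up to a factor `1 + O(s²)`, so the parallelogram law controls the squared
distances to `z` up to `O(s⁶)`; the triangle inequality and the convexity of the square transfer
this to `y` with error `O(s⁶)/s² = O(s⁴)`. -/

lemma fderiv_lineMap_apply_one {V : Type*} [NormedAddCommGroup V] [NormedSpace ℝ V] (x y : V)
    (t : ℝ) : fderiv ℝ (ContinuousAffineMap.lineMap (R := ℝ) x y) t 1 = y - x := by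
  simp

/-! ### Paths and Riemannian distance -/

section Length

variable {n : ℕ} {N : Type*} [MetricSpace N] [ChartedSpace (EuclideanSpace ℝ (Fin n)) N]
  [RiemannianBundle (fun x : N ↦ TangentSpace (𝓡 n) x)] [IsRiemannianManifold (𝓡 n) N]

lemma dist_lt_of_pathELength_lt {γ : ℝ → N} {r : ℝ}
    (hγ : ContMDiffOn 𝓘(ℝ, ℝ) (𝓡 n) 1 γ (Icc 0 1))
    (hlen : pathELength (𝓡 n) γ 0 1 < ENNReal.ofReal r) {t : ℝ} (ht : t ∈ Icc (0 : ℝ) 1) :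
    dist (γ 0) (γ t) < r := by
  have h1 : edist (γ 0) (γ t) ≤ pathELength (𝓡 n) γ 0 t := by
    rw [IsRiemannianManifold.out (I := 𝓡 n)]
    exact riemannianEDist_le_pathELength (hγ.mono (Icc_subset_Icc le_rfl ht.2)) rfl rfl ht.1
  have h2 : edist (γ 0) (γ t) < ENNReal.ofReal r :=
    (h1.trans (pathELength_mono le_rfl ht.2)).trans_lt hlen
  rw [edist_dist] at h2
  exact (ENNReal.ofReal_lt_ofReal_iff_of_nonneg dist_nonneg).1 h2

lemma exists_path_of_dist_lt {x y : N} {r : ℝ} (h : dist x y < r) :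
    ∃ γ : ℝ → N, γ 0 = x ∧ γ 1 = y ∧ ContMDiffOn 𝓘(ℝ, ℝ) (𝓡 n) 1 γ (Icc 0 1) ∧
      pathELength (𝓡 n) γ 0 1 < ENNReal.ofReal r := by
  apply exists_lt_of_riemannianEDist_lt
  rw [← IsRiemannianManifold.out (I := 𝓡 n), edist_dist]
  exact (ENNReal.ofReal_lt_ofReal_iff_of_nonneg dist_nonneg).2 h

end Length

/-- Almost intermediate points for the Riemannian distance. -/
lemma exists_dist_eq_mul (n : ℕ) {N : Type*} [MetricSpace N]
    [ChartedSpace (EuclideanSpace ℝ (Fin n)) N]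
    [RiemannianBundle (fun x : N ↦ TangentSpace (𝓡 n) x)] [IsRiemannianManifold (𝓡 n) N] (x y : N) {τ η : ℝ} (hτ : τ ∈ Icc (0 : ℝ) 1) (hη : 0 < η) :
    ∃ z, dist x z = τ * dist x y ∧ dist z y ≤ (1 - τ) * dist x y + η := by
  obtain ⟨γ, h0, h1, hγ, hlen⟩ :=
    exists_path_of_dist_lt (n := n) (lt_add_of_pos_right (dist x y) hη)
  have hcont : ContinuousOn (fun t ↦ dist x (γ t)) (Icc 0 1) :=
    (continuous_const.dist continuous_id).comp_continuousOn hγ.continuousOn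
  have hmem : τ * dist x y ∈ Icc (dist x (γ 0)) (dist x (γ 1)) := by
    rw [h0, h1, dist_self]
    exact ⟨mul_nonneg hτ.1 dist_nonneg, mul_le_of_le_one_left dist_nonneg hτ.2⟩
  -- The distance from `x` takes the value `τ * dist x y` along an almost minimizing path; the
  -- length still available bounds the distance to `y`.
  obtain ⟨t, ht, htτ⟩ := intermediate_value_Icc zero_le_one hcont hmem
  simp only at htτ
  refine ⟨γ t, htτ, ?_⟩
  have e1 : edist x (γ t) ≤ pathELength (𝓡 n) γ 0 t := by
    rw [IsRiemannianManifold.out (I := 𝓡 n)]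
    exact riemannianEDist_le_pathELength (hγ.mono (Icc_subset_Icc le_rfl ht.2)) h0 rfl ht.1
  have e2 : edist (γ t) y ≤ pathELength (𝓡 n) γ t 1 := by
    rw [IsRiemannianManifold.out (I := 𝓡 n)]
    exact riemannianEDist_le_pathELength (hγ.mono (Icc_subset_Icc ht.1 le_rfl)) rfl h1 ht.2
  have e3 : edist x (γ t) + edist (γ t) y < ENNReal.ofReal (dist x y + η) :=
    (add_le_add e1 e2).trans_lt (by rwa [pathELength_add ht.1 ht.2])
  rw [edist_dist, edist_dist, ← ENNReal.ofReal_add dist_nonneg dist_nonneg,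
    ENNReal.ofReal_lt_ofReal_iff_of_nonneg (by positivity), htτ] at e3
  linarith

/-! ### The Riemannian metric in a chart -/

section Geometry

variable {n : ℕ} {N : Type*} [MetricSpace N]
  [ChartedSpace (EuclideanSpace ℝ (Fin n)) N] [IsManifold (𝓡 n) ∞ N]

variable (n) in
/-- The coordinate frame at `x` of the preferred chart at `x₀`. -/
def frame (x₀ x : N) : EuclideanSpace ℝ (Fin n) →L[ℝ] TangentSpace (𝓡 n) x :=
  (trivializationAt (EuclideanSpace ℝ (Fin n)) (TangentSpace (𝓡 n)) x₀).symmL ℝ x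

variable (n) in
/-- The coordinate coframe at `x` of the preferred chart at `x₀`. -/
def coframe (x₀ x : N) : TangentSpace (𝓡 n) x →L[ℝ] EuclideanSpace ℝ (Fin n) :=
  (trivializationAt (EuclideanSpace ℝ (Fin n)) (TangentSpace (𝓡 n)) x₀).continuousLinearMapAt ℝ x

lemma frame_coframe {x₀ x : N} (hx : x ∈ (chartAt (EuclideanSpace ℝ (Fin n)) x₀).source)
    (v : TangentSpace (𝓡 n) x) : frame n x₀ (x) (coframe n x₀ x v) = v :=
  (trivializationAt (EuclideanSpace ℝ (Fin n)) (TangentSpace (𝓡 n)) x₀).symmL_continuousLinearMapAt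
    (by simpa using hx) v

lemma coframe_frame {x₀ x : N} (hx : x ∈ (chartAt (EuclideanSpace ℝ (Fin n)) x₀).source)
    (w : EuclideanSpace ℝ (Fin n)) : coframe n x₀ (x) (frame n x₀ x w) = w :=
  (trivializationAt (EuclideanSpace ℝ (Fin n)) (TangentSpace (𝓡 n)) x₀).continuousLinearMapAt_symmL
    (by simpa using hx) w

lemma frame_apply {x₀ x : N} (hx : x ∈ (chartAt (EuclideanSpace ℝ (Fin n)) x₀).source)
    (w : EuclideanSpace ℝ (Fin n)) : frame n x₀ x w =
      (trivializationAt (EuclideanSpace ℝ (Fin n)) (TangentSpace (𝓡 n)) x₀).symm x w :=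
  Trivialization.symmL_apply _ (by simpa using hx) _

lemma mfderiv_extChartAt_eq_coframe {x₀ x : N}
    (hx : x ∈ (chartAt (EuclideanSpace ℝ (Fin n)) x₀).source) :
    mfderiv (𝓡 n) 𝓘(ℝ, EuclideanSpace ℝ (Fin n)) (extChartAt (𝓡 n) x₀) x = coframe n x₀ x :=
  (TangentBundle.continuousLinearMapAt_trivializationAt hx).symm

lemma mfderivWithin_extChartAt_symm_eq_frame {x₀ x : N}
    (hx : x ∈ (chartAt (EuclideanSpace ℝ (Fin n)) x₀).source) :
    mfderivWithin 𝓘(ℝ, EuclideanSpace ℝ (Fin n)) (𝓡 n) (extChartAt (𝓡 n) x₀).symm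
      (range (𝓡 n)) (extChartAt (𝓡 n) x₀ x) = frame n x₀ x :=
  (TangentBundle.symmL_trivializationAt hx).symm

variable [RiemannianBundle (fun x : N ↦ TangentSpace (𝓡 n) x)]

/-- The coordinate velocity of `γ` is the coframe applied to its velocity, so `hL` bounds the speed
of `T` applied to the coordinates by `L` times the Riemannian speed. It serves with `T` the identity
and with `T` the frame frozen at one point. -/
lemma enorm_clm_sub_le_of_path {x₀ : N} {γ : ℝ → N} {F : Type*} [NormedAddCommGroup F]
    [NormedSpace ℝ F] (T : EuclideanSpace ℝ (Fin n) →L[ℝ] F) {L : ℝ} (hL0 : 0 ≤ L)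
    (hγ : ContMDiffOn 𝓘(ℝ, ℝ) (𝓡 n) 1 γ (Icc 0 1))
    (hs : ∀ t ∈ Icc (0 : ℝ) 1, γ t ∈ (chartAt (EuclideanSpace ℝ (Fin n)) x₀).source)
    (hL : ∀ t ∈ Icc (0 : ℝ) 1, ∀ w, ‖T w‖ ≤ L * ‖frame n x₀ (γ t) w‖) :
    ‖T (extChartAt (𝓡 n) x₀ (γ 1) - extChartAt (𝓡 n) x₀ (γ 0))‖ₑ ≤
      ENNReal.ofReal L * pathELength (𝓡 n) γ 0 1 := by
  let γ' := T ∘ extChartAt (𝓡 n) x₀ ∘ γ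
  have hc0 : ContMDiffOn 𝓘(ℝ, ℝ) 𝓘(ℝ, EuclideanSpace ℝ (Fin n)) 1
      (extChartAt (𝓡 n) x₀ ∘ γ) (Icc 0 1) :=
    contMDiffOn_extChartAt.comp (t := (chartAt (EuclideanSpace ℝ (Fin n)) x₀).source) hγ hs
  have hc0' : ContDiffOn ℝ 1 (extChartAt (𝓡 n) x₀ ∘ γ) (Icc 0 1) :=
    contMDiffOn_iff_contDiffOn.1 hc0
  have hc : ContDiffOn ℝ 1 γ' (Icc 0 1) := T.contDiff.comp_contDiffOn hc0'
  calc ‖T (extChartAt (𝓡 n) x₀ (γ 1) - extChartAt (𝓡 n) x₀ (γ 0))‖ₑ = ‖γ' 1 - γ' 0‖ₑ := by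
        simp [γ', Function.comp, map_sub]
    _ ≤ ∫⁻ t in Icc (0 : ℝ) 1, ‖derivWithin γ' (Icc 0 1) t‖ₑ :=
        enorm_sub_le_lintegral_derivWithin_Icc_of_contDiffOn_Icc hc zero_le_one
    _ ≤ ∫⁻ t in Icc (0 : ℝ) 1, ENNReal.ofReal L *
          ‖mfderivWithin 𝓘(ℝ, ℝ) (𝓡 n) γ (Icc 0 1) t 1‖ₑ := by
        refine setLIntegral_mono' measurableSet_Icc fun t ht ↦ ?_
        have hu := uniqueDiffOn_Icc (zero_lt_one (α := ℝ)) t ht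
        have h1 : derivWithin γ' (Icc 0 1) t =
            T (fderivWithin ℝ (extChartAt (𝓡 n) x₀ ∘ γ) (Icc 0 1) t 1) := by
          rw [← fderivWithin_derivWithin]
          have := fderiv_comp_fderivWithin t T.differentiableAt
            (hc0'.differentiableOn one_ne_zero t ht) hu
          rw [this]; simp
        have h2 : mfderivWithin 𝓘(ℝ, ℝ) 𝓘(ℝ, EuclideanSpace ℝ (Fin n)) (extChartAt (𝓡 n) x₀ ∘ γ)
            (Icc 0 1) t = (mfderiv (𝓡 n) 𝓘(ℝ, EuclideanSpace ℝ (Fin n)) (extChartAt (𝓡 n) x₀)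
              (γ t)) ∘L (mfderivWithin 𝓘(ℝ, ℝ) (𝓡 n) γ (Icc 0 1) t) := by
          apply mfderiv_comp_mfderivWithin
          · exact mdifferentiableAt_extChartAt (hs t ht)
          · exact hγ.mdifferentiableOn one_ne_zero t ht
          · rw [uniqueMDiffWithinAt_iff_uniqueDiffWithinAt]; exact hu
        rw [mfderivWithin_eq_fderivWithin, mfderiv_extChartAt_eq_coframe (hs t ht)] at h2
        have h3 : fderivWithin ℝ (extChartAt (𝓡 n) x₀ ∘ γ) (Icc 0 1) t 1 =
            coframe n x₀ (γ t) (mfderivWithin 𝓘(ℝ, ℝ) (𝓡 n) γ (Icc 0 1) t 1) := by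
          rw [h2]; rfl
        have h4 := hL t ht (coframe n x₀ (γ t) (mfderivWithin 𝓘(ℝ, ℝ) (𝓡 n) γ (Icc 0 1) t 1))
        rw [frame_coframe (hs t ht)] at h4
        rw [h1, h3, ← ofReal_norm, ← ofReal_norm, ← ENNReal.ofReal_mul hL0]
        exact ENNReal.ofReal_le_ofReal h4
    _ = _ := by
        rw [lintegral_const_mul' _ _ ENNReal.ofReal_ne_top,
          pathELength_eq_lintegral_mfderivWithin_Icc]

variable (n) in
/-- The Riemannian length of the vector with coordinates `w` at the point with coordinates `z` in
the preferred chart at `x₀`. -/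
def chartNorm (x₀ : N) (z w : EuclideanSpace ℝ (Fin n)) : ℝ :=
  ‖frame n x₀ ((extChartAt (𝓡 n) x₀).symm z) w‖

/-- Uniform control of the Riemannian metric on the ball of radius `R` in the preferred chart
at `x₀`. -/
structure ChartBound (x₀ : N) (R K : ℝ) : Prop where
  radius_pos : 0 < R
  one_le : 1 ≤ K
  ball_subset : ball (extChartAt (𝓡 n) x₀ x₀) R ⊆ (extChartAt (𝓡 n) x₀).target
  chartNorm_le : ∀ z ∈ ball (extChartAt (𝓡 n) x₀ x₀) R, ∀ w, chartNorm n x₀ z w ≤ K * ‖w‖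
  le_chartNorm : ∀ z ∈ ball (extChartAt (𝓡 n) x₀ x₀) R, ∀ w, ‖w‖ ≤ K * chartNorm n x₀ z w
  chartNorm_le_mul : ∀ z ∈ ball (extChartAt (𝓡 n) x₀ x₀) R,
    ∀ z' ∈ ball (extChartAt (𝓡 n) x₀ x₀) R, ∀ w,
      chartNorm n x₀ z w ≤ (1 + K * ‖z - z'‖) * chartNorm n x₀ z' w
  continuousOn : ∀ w, ContinuousOn (fun z ↦ chartNorm n x₀ z w) (ball (extChartAt (𝓡 n) x₀ x₀) R)

lemma chartNorm_extChartAt {x₀ x : N} (hx : x ∈ (chartAt (EuclideanSpace ℝ (Fin n)) x₀).source)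
    (w : EuclideanSpace ℝ (Fin n)) :
    chartNorm n x₀ (extChartAt (𝓡 n) x₀ x) w = ‖frame n x₀ x w‖ := by
  rw [chartNorm, (extChartAt (𝓡 n) x₀).left_inv (by simpa using hx)]

/-- The radius of a metric ball on which the chart takes values in the controlled ball. -/
lemma ChartBound.exists_ball_subset {x₀ : N} {R K : ℝ} (h : ChartBound (n := n) x₀ R K) :
    ∃ σ > 0, ∀ x ∈ ball x₀ σ, x ∈ (chartAt (EuclideanSpace ℝ (Fin n)) x₀).source ∧
      extChartAt (𝓡 n) x₀ x ∈ ball (extChartAt (𝓡 n) x₀ x₀) R := by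
  have h1 : ∀ᶠ x in 𝓝 x₀, x ∈ (chartAt (EuclideanSpace ℝ (Fin n)) x₀).source ∧
      extChartAt (𝓡 n) x₀ x ∈ ball (extChartAt (𝓡 n) x₀ x₀) R :=
    Filter.Eventually.and (chart_source_mem_nhds (EuclideanSpace ℝ (Fin n)) x₀)
      ((continuousAt_extChartAt (I := 𝓡 n) x₀).preimage_mem_nhds (ball_mem_nhds _ h.radius_pos))
  exact Metric.eventually_nhds_iff_ball.1 h1

/-! ### Comparison of distances with coordinate norms -/

section Path

variable [IsRiemannianManifold (𝓡 n) N]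

/-- The coordinate segment is a competitor for the distance; its speed at the point `p` is
`chartNorm n x₀ p (z' - z)`. -/
lemma dist_symm_le_of_forall_segment {x₀ : N} {z z' : EuclideanSpace ℝ (Fin n)} {L : ℝ}
    (hs : segment ℝ z z' ⊆ (extChartAt (𝓡 n) x₀).target)
    (hL : ∀ p ∈ segment ℝ z z', chartNorm n x₀ p (z' - z) ≤ L) :
    dist ((extChartAt (𝓡 n) x₀).symm z) ((extChartAt (𝓡 n) x₀).symm z') ≤ L := by
  have hL0 : 0 ≤ L := (norm_nonneg _).trans (hL z (left_mem_segment ℝ z z'))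
  let η := ContinuousAffineMap.lineMap (R := ℝ) z z'
  let γ := (extChartAt (𝓡 n) x₀).symm ∘ η
  have hη : ∀ t ∈ Icc (0 : ℝ) 1, η t ∈ segment ℝ z z' := by
    intro t ht
    rw [segment_eq_image_lineMap]
    exact ⟨t, ht, by simp [η, ContinuousAffineMap.coe_lineMap_eq]⟩
  have hη' : Icc (0 : ℝ) 1 ⊆ η ⁻¹' (extChartAt (𝓡 n) x₀).target := fun t ht ↦ hs (hη t ht)
  have η_smooth : ContMDiffOn 𝓘(ℝ, ℝ) 𝓘(ℝ, EuclideanSpace ℝ (Fin n)) 1 η (Icc 0 1) := by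
    apply ContMDiff.contMDiffOn
    rw [contMDiff_iff_contDiff]
    exact ContinuousAffineMap.contDiff _
  have h1 : riemannianEDist (𝓡 n) ((extChartAt (𝓡 n) x₀).symm z)
      ((extChartAt (𝓡 n) x₀).symm z') ≤ pathELength (𝓡 n) γ 0 1 := by
    apply riemannianEDist_le_pathELength _ _ _ zero_le_one
    · exact (contMDiffOn_extChartAt_symm x₀).comp η_smooth hη'
    · simp [γ, η, ContinuousAffineMap.coe_lineMap_eq]
    · simp [γ, η, ContinuousAffineMap.coe_lineMap_eq]
  have h2 : pathELength (𝓡 n) γ 0 1 ≤ ∫⁻ _ in Icc (0 : ℝ) 1, ENNReal.ofReal L := by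
    rw [pathELength_eq_lintegral_mfderivWithin_Icc]
    refine setLIntegral_mono' measurableSet_Icc fun t ht ↦ ?_
    have h3 : mfderivWithin 𝓘(ℝ, ℝ) (𝓡 n) γ (Icc 0 1) t =
        (mfderivWithin 𝓘(ℝ, EuclideanSpace ℝ (Fin n)) (𝓡 n) (extChartAt (𝓡 n) x₀).symm
          (range (𝓡 n)) (η t)) ∘L (mfderivWithin 𝓘(ℝ, ℝ) 𝓘(ℝ, EuclideanSpace ℝ (Fin n)) η
            (Icc 0 1) t) := by
      apply mfderivWithin_comp
      · exact mdifferentiableWithinAt_extChartAt_symm (hη' ht)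
      · exact η_smooth.mdifferentiableOn one_ne_zero t ht
      · exact hη'.trans (preimage_mono (extChartAt_target_subset_range x₀))
      · rw [uniqueMDiffWithinAt_iff_uniqueDiffWithinAt]
        exact uniqueDiffOn_Icc zero_lt_one t ht
    have hz' : (extChartAt (𝓡 n) x₀).symm (η t) ∈
        (chartAt (EuclideanSpace ℝ (Fin n)) x₀).source := by
      simpa using (extChartAt (𝓡 n) x₀).map_target (hη' ht)
    have h4 : mfderivWithin 𝓘(ℝ, EuclideanSpace ℝ (Fin n)) (𝓡 n) (extChartAt (𝓡 n) x₀).symm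
          (range (𝓡 n)) (η t) = frame n x₀ ((extChartAt (𝓡 n) x₀).symm (η t)) := by
      rw [← mfderivWithin_extChartAt_symm_eq_frame hz', (extChartAt (𝓡 n) x₀).right_inv (hη' ht)]
    have h5 : mfderivWithin 𝓘(ℝ, ℝ) 𝓘(ℝ, EuclideanSpace ℝ (Fin n)) η (Icc 0 1) t 1 = z' - z := by
      rw [mfderivWithin_eq_fderivWithin,
        fderivWithin_eq_fderiv (uniqueDiffOn_Icc zero_lt_one _ ht)
          (ContinuousAffineMap.differentiableAt _)]
      exact fderiv_lineMap_apply_one z z' t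
    have h6 : mfderivWithin 𝓘(ℝ, ℝ) (𝓡 n) γ (Icc 0 1) t 1 =
        frame n x₀ ((extChartAt (𝓡 n) x₀).symm (η t)) (z' - z) := by
      rw [h3, ← h5, ← h4]; rfl
    rw [h6, ← ofReal_norm]
    exact ENNReal.ofReal_le_ofReal (hL _ (hη t ht))
  have h3 : edist ((extChartAt (𝓡 n) x₀).symm z) ((extChartAt (𝓡 n) x₀).symm z') ≤
      ENNReal.ofReal L := by
    rw [IsRiemannianManifold.out (I := 𝓡 n)]
    exact (h1.trans h2).trans (by simp)
  rw [edist_dist] at h3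
  exact (ENNReal.ofReal_le_ofReal_iff hL0).1 h3


namespace ChartBound

variable {x₀ : N} {R K : ℝ}

lemma dist_symm_le (h : ChartBound (n := n) x₀ R K) {z z' a : EuclideanSpace ℝ (Fin n)} {ρ : ℝ}
    (hz : z ∈ ball (extChartAt (𝓡 n) x₀ x₀) R) (hz' : z' ∈ ball (extChartAt (𝓡 n) x₀ x₀) R)
    (ha : a ∈ ball (extChartAt (𝓡 n) x₀ x₀) R) (hzρ : ‖z - a‖ ≤ ρ) (hzρ' : ‖z' - a‖ ≤ ρ) :
    dist ((extChartAt (𝓡 n) x₀).symm z) ((extChartAt (𝓡 n) x₀).symm z') ≤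
      (1 + K * ρ) * chartNorm n x₀ a (z' - z) := by
  have hseg : segment ℝ z z' ⊆ ball (extChartAt (𝓡 n) x₀ x₀) R :=
    (convex_ball _ _).segment_subset hz hz'
  refine dist_symm_le_of_forall_segment (hseg.trans h.ball_subset) fun p hp ↦ ?_
  refine (h.chartNorm_le_mul p (hseg hp) a ha _).trans ?_
  have hp' : p ∈ closedBall a ρ := (convex_closedBall a ρ).segment_subset
    (by rwa [mem_closedBall, dist_eq_norm]) (by rwa [mem_closedBall, dist_eq_norm]) hp
  rw [mem_closedBall, dist_eq_norm] at hp'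
  have : 0 ≤ chartNorm n x₀ a (z' - z) := norm_nonneg _
  have := h.one_le
  gcongr

lemma dist_symm_le_norm (h : ChartBound (n := n) x₀ R K) {z z' : EuclideanSpace ℝ (Fin n)}
    (hz : z ∈ ball (extChartAt (𝓡 n) x₀ x₀) R) (hz' : z' ∈ ball (extChartAt (𝓡 n) x₀ x₀) R) :
    dist ((extChartAt (𝓡 n) x₀).symm z) ((extChartAt (𝓡 n) x₀).symm z') ≤ K * ‖z' - z‖ :=
  have hseg : segment ℝ z z' ⊆ ball (extChartAt (𝓡 n) x₀ x₀) R :=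
    (convex_ball _ _).segment_subset hz hz'
  dist_symm_le_of_forall_segment (hseg.trans h.ball_subset) fun p hp ↦
    h.chartNorm_le p (hseg hp) _

/-- An almost minimizing path from `x` to `x'` cannot leave the ball of radius `σ` around `x₀`,
where the chart is controlled, so its length bounds the coordinate increment. -/
lemma norm_extChartAt_sub_le (h : ChartBound (n := n) x₀ R K) {σ : ℝ}
    (hσ : ∀ x ∈ ball x₀ σ, x ∈ (chartAt (EuclideanSpace ℝ (Fin n)) x₀).source ∧
      extChartAt (𝓡 n) x₀ x ∈ ball (extChartAt (𝓡 n) x₀ x₀) R) {x x' : N}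
    (hx : dist x x₀ + dist x x' < σ) :
    ‖extChartAt (𝓡 n) x₀ x' - extChartAt (𝓡 n) x₀ x‖ ≤ K * dist x x' := by
  have hK := h.one_le
  have key : ∀ r, dist x x' < r → r < σ - dist x x₀ →
      ‖extChartAt (𝓡 n) x₀ x' - extChartAt (𝓡 n) x₀ x‖ ≤ K * r := by
    intro r hr hr'
    have hr0 : 0 ≤ r := dist_nonneg.trans hr.le
    obtain ⟨γ, h0, h1, hγ, hlen⟩ := exists_path_of_dist_lt (n := n) hr
    have hb : ∀ t ∈ Icc (0 : ℝ) 1, γ t ∈ ball x₀ σ := fun t ht ↦ by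
      have := dist_lt_of_pathELength_lt hγ hlen ht
      rw [h0] at this
      rw [mem_ball]
      linarith [dist_triangle_left (γ t) x₀ x]
    have := enorm_clm_sub_le_of_path (ContinuousLinearMap.id ℝ (EuclideanSpace ℝ (Fin n)))
      (by positivity : 0 ≤ K) hγ (fun t ht ↦ (hσ _ (hb t ht)).1) (fun t ht w ↦ by
        rw [← chartNorm_extChartAt (hσ _ (hb t ht)).1]
        exact h.le_chartNorm _ (hσ _ (hb t ht)).2 w)
    replace this := this.trans (mul_le_mul_right hlen.le _)
    rw [h0, h1, ← ENNReal.ofReal_mul (by positivity), ← ofReal_norm,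
      ENNReal.ofReal_le_ofReal_iff (by positivity)] at this
    exact this
  -- No minimizing path is assumed to exist: the bound holds for every `r` above the distance and
  -- passes to the limit.
  have h3 : Tendsto (fun r ↦ K * r) (𝓝[>] (dist x x')) (𝓝 (K * dist x x')) :=
    ((continuous_const.mul continuous_id).tendsto _).mono_left nhdsWithin_le_nhds
  refine ge_of_tendsto h3 ?_
  filter_upwards [Ioo_mem_nhdsGT (show dist x x' < σ - dist x x₀ by linarith)] with r hr
  exact key r hr.1 hr.2

/-- Converse of `dist_symm_le`: along an almost minimizing path the coordinates stay within about `ρ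
+ K * dist x x'` of `a`, so replacing the metric by the one frozen at `a` costs only the
corresponding factor. -/
lemma chartNorm_extChartAt_sub_le (h : ChartBound (n := n) x₀ R K) {σ : ℝ}
    (hσ : ∀ x ∈ ball x₀ σ, x ∈ (chartAt (EuclideanSpace ℝ (Fin n)) x₀).source ∧
      extChartAt (𝓡 n) x₀ x ∈ ball (extChartAt (𝓡 n) x₀ x₀) R) {x x' : N}
    (hx : dist x x₀ + 2 * dist x x' < σ) {a : EuclideanSpace ℝ (Fin n)} {ρ : ℝ}
    (ha : a ∈ ball (extChartAt (𝓡 n) x₀ x₀) R) (hρ : ‖a - extChartAt (𝓡 n) x₀ x‖ ≤ ρ) :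
    chartNorm n x₀ a (extChartAt (𝓡 n) x₀ x' - extChartAt (𝓡 n) x₀ x) ≤
      (1 + K * (ρ + K * dist x x')) * dist x x' := by
  have hK := h.one_le
  have hρ0 : 0 ≤ ρ := (norm_nonneg _).trans hρ
  have key : ∀ r, dist x x' < r → r < (σ - dist x x₀) / 2 →
      chartNorm n x₀ a (extChartAt (𝓡 n) x₀ x' - extChartAt (𝓡 n) x₀ x) ≤
        (1 + K * (ρ + K * r)) * r := by
    intro r hr hr'
    have hr0 : 0 ≤ r := dist_nonneg.trans hr.le
    obtain ⟨γ, h0, h1, hγ, hlen⟩ := exists_path_of_dist_lt (n := n) hr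
    have hd : ∀ t ∈ Icc (0 : ℝ) 1, dist x (γ t) < r := fun t ht ↦ by
      have := dist_lt_of_pathELength_lt hγ hlen ht
      rwa [h0] at this
    have hb : ∀ t ∈ Icc (0 : ℝ) 1, γ t ∈ ball x₀ σ := fun t ht ↦ by
      rw [mem_ball]
      linarith [dist_triangle_left (γ t) x₀ x, hd t ht]
    have := enorm_clm_sub_le_of_path (frame n x₀ ((extChartAt (𝓡 n) x₀).symm a))
      (by positivity : 0 ≤ 1 + K * (ρ + K * r)) hγ (fun t ht ↦ (hσ _ (hb t ht)).1)
      (fun t ht w ↦ by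
        rw [← chartNorm_extChartAt (hσ _ (hb t ht)).1]
        refine (h.chartNorm_le_mul a ha _ (hσ _ (hb t ht)).2 w).trans ?_
        have hn : ‖a - extChartAt (𝓡 n) x₀ (γ t)‖ ≤ ρ + K * r := by
          have h2 := h.norm_extChartAt_sub_le hσ (x := x) (x' := γ t) (by linarith [hd t ht])
          calc _ ≤ ‖a - extChartAt (𝓡 n) x₀ x‖ +
                ‖extChartAt (𝓡 n) x₀ (γ t) - extChartAt (𝓡 n) x₀ x‖ := by
                  rw [norm_sub_rev (extChartAt (𝓡 n) x₀ (γ t))]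
                  exact norm_sub_le_norm_sub_add_norm_sub _ _ _
            _ ≤ ρ + K * r := by
                  refine add_le_add hρ (h2.trans ?_)
                  have := (hd t ht).le
                  gcongr
        have : 0 ≤ chartNorm n x₀ (extChartAt (𝓡 n) x₀ (γ t)) w := norm_nonneg _
        gcongr)
    replace this := this.trans (mul_le_mul_right hlen.le _)
    rw [h0, h1, ← ENNReal.ofReal_mul (by positivity), ← ofReal_norm,
      ENNReal.ofReal_le_ofReal_iff (by positivity)] at this
    exact this
  have h3 : Tendsto (fun r ↦ (1 + K * (ρ + K * r)) * r) (𝓝[>] (dist x x'))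
      (𝓝 ((1 + K * (ρ + K * dist x x')) * dist x x')) := by
    have : Continuous fun r ↦ (1 + K * (ρ + K * r)) * r := by fun_prop
    exact (this.tendsto _).mono_left nhdsWithin_le_nhds
  refine ge_of_tendsto h3 ?_
  filter_upwards [Ioo_mem_nhdsGT (show dist x x' < (σ - dist x x₀) / 2 by linarith)] with r hr
  exact key r hr.1 hr.2

end ChartBound

end Path

/-! ### Existence of controlled charts -/

section Existence

variable [IsContMDiffRiemannianBundle (𝓡 n) ∞ (EuclideanSpace ℝ (Fin n))
      (fun x : N ↦ TangentSpace (𝓡 n) x)]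

instance isContinuousRiemannianBundle_tangentSpace :
    IsContinuousRiemannianBundle (EuclideanSpace ℝ (Fin n))
      (fun x : N ↦ TangentSpace (𝓡 n) x) := by
  obtain ⟨g, hg, hgi⟩ := IsContMDiffRiemannianBundle.exists_contMDiff (IB := 𝓡 n) (n := ∞)
    (F := EuclideanSpace ℝ (Fin n)) (E := fun x : N ↦ TangentSpace (𝓡 n) x)
  exact ⟨g, hg.continuous, hgi⟩

/-- The Riemannian metric, read in the coordinate frame of a chart, is locally Lipschitz. -/
lemma exists_lipschitz_metric (x₀ : N) :
    ∃ G : EuclideanSpace ℝ (Fin n) → (EuclideanSpace ℝ (Fin n) →L[ℝ]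
        EuclideanSpace ℝ (Fin n) →L[ℝ] ℝ),
      (∃ C : ℝ≥0, ∃ t ∈ 𝓝 (extChartAt (𝓡 n) x₀ x₀), LipschitzOnWith C G t) ∧
      ∀ z ∈ (extChartAt (𝓡 n) x₀).target, ∀ w w',
        G z w w' = inner ℝ (frame n x₀ ((extChartAt (𝓡 n) x₀).symm z) w)
          (frame n x₀ ((extChartAt (𝓡 n) x₀).symm z) w') := by
  obtain ⟨g, hg, hgi⟩ := IsContMDiffRiemannianBundle.exists_contMDiff (IB := 𝓡 n) (n := ∞)
    (F := EuclideanSpace ℝ (Fin n)) (E := fun x : N ↦ TangentSpace (𝓡 n) x)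
  have h1 := (contMDiffAt_section x₀).1 (hg x₀)
  set H : N → (EuclideanSpace ℝ (Fin n) →L[ℝ] EuclideanSpace ℝ (Fin n) →L[ℝ] ℝ) :=
    fun x ↦ (trivializationAt (EuclideanSpace ℝ (Fin n) →L[ℝ] EuclideanSpace ℝ (Fin n) →L[ℝ] ℝ)
    (fun x : N ↦ TangentSpace (𝓡 n) x →L[ℝ] TangentSpace (𝓡 n) x →L[ℝ] ℝ) x₀ ⟨x, g x⟩).2 with hH
  refine ⟨H ∘ (extChartAt (𝓡 n) x₀).symm, ?_, ?_⟩
  · have h2 : ContDiffAt ℝ ∞ (H ∘ (extChartAt (𝓡 n) x₀).symm) (extChartAt (𝓡 n) x₀ x₀) := by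
      have h3 : ContDiffWithinAt ℝ ∞ (H ∘ (extChartAt (𝓡 n) x₀).symm) (range (𝓡 n))
        (extChartAt (𝓡 n) x₀ x₀) := by
          have := (contMDiffAt_iff.1 h1).2
          exact this
      rwa [show range (𝓡 n) = univ by simp, contDiffWithinAt_univ] at h3
    exact (h2.of_le (by simp)).exists_lipschitzOnWith
  · intro z hz w w'
    have hz' : (extChartAt (𝓡 n) x₀).symm z ∈ (chartAt (EuclideanSpace ℝ (Fin n)) x₀).source := by
      simpa using (extChartAt (𝓡 n) x₀).map_target hz
    rw [hgi]
    simp only [hH, Function.comp]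
    rw [hom_trivializationAt_apply]
    simp only
    rw [inCoordinates_apply_eq₂]
    · rw [frame_apply hz', frame_apply hz']
      simp
    · simpa using hz'
    · simpa using hz'
    · simp

-- The two-sided bounds with `C₁`, `C₂` come from the continuity of the metric. For the
-- multiplicative one, the squared lengths of `w` at `z` and `z'` differ by at most `C * ‖z - z'‖ *
-- ‖w‖ ^ 2`, and `‖w‖` is at most `C₂` times the length at `z'`; hence the term `C * C₂ ^ 2` in `K`.
set_option synthInstance.maxHeartbeats 200000 in
lemma exists_chartBound (x₀ : N) : ∃ R K, ChartBound (n := n) x₀ R K := by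
  obtain ⟨G, ⟨C, t, ht, hC⟩, hG⟩ := exists_lipschitz_metric (n := n) x₀
  obtain ⟨C₁, hC₁, h₁⟩ := eventually_norm_symmL_trivializationAt_lt
    (EuclideanSpace ℝ (Fin n)) (fun x : N ↦ TangentSpace (𝓡 n) x) x₀
  obtain ⟨C₂, hC₂, h₂⟩ := eventually_norm_trivializationAt_lt
    (EuclideanSpace ℝ (Fin n)) (fun x : N ↦ TangentSpace (𝓡 n) x) x₀
  have hcont : Tendsto (extChartAt (𝓡 n) x₀).symm (𝓝 (extChartAt (𝓡 n) x₀ x₀)) (𝓝 x₀) := by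
    simpa only [extChartAt_to_inv] using (continuousAt_extChartAt_symm (I := 𝓡 n) x₀).tendsto
  obtain ⟨R, hR, hball⟩ := Metric.mem_nhds_iff.1 (inter_mem (inter_mem ht
    (extChartAt_target_mem_nhds (I := 𝓡 n) x₀)) (inter_mem (hcont h₁) (hcont h₂)))
  set K := 1 + C₁ + C₂ + C * C₂ ^ 2 with hK
  have hCn : (0 : ℝ) ≤ C := C.2
  have hK₁ : C₁ ≤ K := by have : 0 ≤ C * C₂ ^ 2 := by positivity
                          linarith
  have hK₂ : C₂ ≤ K := by have : 0 ≤ C * C₂ ^ 2 := by positivity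
                          linarith
  have hup : ∀ z ∈ ball (extChartAt (𝓡 n) x₀ x₀) R, ∀ w, chartNorm n x₀ z w ≤ C₁ * ‖w‖ := by
    intro z hz w
    have h : ‖frame n x₀ ((extChartAt (𝓡 n) x₀).symm z)‖ < C₁ := (hball hz).2.1
    exact (ContinuousLinearMap.le_opNorm _ _).trans (by gcongr)
  have hlow : ∀ z ∈ ball (extChartAt (𝓡 n) x₀ x₀) R, ∀ w, ‖w‖ ≤ C₂ * chartNorm n x₀ z w := by
    intro z hz w
    have h : ‖coframe n x₀ ((extChartAt (𝓡 n) x₀).symm z)‖ < C₂ := (hball hz).2.2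
    have hz' : (extChartAt (𝓡 n) x₀).symm z ∈ (chartAt (EuclideanSpace ℝ (Fin n)) x₀).source := by
      simpa using (extChartAt (𝓡 n) x₀).map_target (hball hz).1.2
    calc ‖w‖ = ‖coframe n x₀ _ (frame n x₀ ((extChartAt (𝓡 n) x₀).symm z) w)‖ := by
          rw [coframe_frame hz']
      _ ≤ _ := (ContinuousLinearMap.le_opNorm _ _).trans (by rw [chartNorm]; gcongr)
  have hsq : ∀ z ∈ ball (extChartAt (𝓡 n) x₀ x₀) R, ∀ w, G z w w = chartNorm n x₀ z w ^ 2 := by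
    intro z hz w
    rw [hG z (hball hz).1.2, chartNorm, real_inner_self_eq_norm_sq]
  have hlip : ∀ z ∈ ball (extChartAt (𝓡 n) x₀ x₀) R, ∀ z' ∈ ball (extChartAt (𝓡 n) x₀ x₀) R,
      ∀ w, |G z w w - G z' w w| ≤ C * ‖z - z'‖ * ‖w‖ ^ 2 := by
    intro z hz z' hz' w
    have h := hC.dist_le_mul z (hball hz).1.1 z' (hball hz').1.1
    rw [dist_eq_norm, dist_eq_norm] at h
    calc |G z w w - G z' w w| = ‖(G z - G z') w w‖ := by simp
      _ ≤ ‖G z - G z'‖ * ‖w‖ * ‖w‖ := ContinuousLinearMap.le_opNorm₂ _ _ _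
      _ ≤ C * ‖z - z'‖ * ‖w‖ ^ 2 := by
        rw [mul_assoc, ← sq]; gcongr
  have hKpos : 0 ≤ K := by positivity
  refine ⟨R, K, hR, ?_, fun z hz ↦ (hball hz).1.2, ?_, ?_, ?_, ?_⟩
  · have : 0 ≤ C * C₂ ^ 2 := by positivity
    linarith
  · intro z hz w
    exact (hup z hz w).trans (by gcongr)
  · intro z hz w
    have : 0 ≤ chartNorm n x₀ z w := norm_nonneg _
    exact (hlow z hz w).trans (by gcongr)
  · intro z hz z' hz' w
    have h0 : 0 ≤ chartNorm n x₀ z w := norm_nonneg _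
    have h0' : 0 ≤ chartNorm n x₀ z' w := norm_nonneg _
    have hzz : 0 ≤ ‖z - z'‖ := norm_nonneg _
    -- On squares it suffices that `1 + t ≤ (1 + t) ^ 2` for `t = K * ‖z - z'‖`.
    refine abs_le_of_sq_le_sq' ?_ (by positivity) |>.2
    have h1 := (abs_le.1 (hlip z hz z' hz' w)).2
    rw [hsq z hz, hsq z' hz'] at h1
    have h2 : ‖w‖ ^ 2 ≤ C₂ ^ 2 * chartNorm n x₀ z' w ^ 2 := by
      rw [← mul_pow]; exact pow_le_pow_left₀ (norm_nonneg _) (hlow z' hz' w) 2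
    have h3 : C * ‖z - z'‖ * ‖w‖ ^ 2 ≤ K * ‖z - z'‖ * chartNorm n x₀ z' w ^ 2 := by
      calc C * ‖z - z'‖ * ‖w‖ ^ 2 ≤ C * ‖z - z'‖ * (C₂ ^ 2 * chartNorm n x₀ z' w ^ 2) := by gcongr
        _ = (C * C₂ ^ 2) * ‖z - z'‖ * chartNorm n x₀ z' w ^ 2 := by ring
        _ ≤ _ := by gcongr; linarith
    have h4 : 0 ≤ K * ‖z - z'‖ := by positivity
    nlinarith [mul_nonneg h4 (sq_nonneg (chartNorm n x₀ z' w)),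
      mul_nonneg (mul_nonneg h4 h4) (sq_nonneg (chartNorm n x₀ z' w))]
  · intro w
    have h1 : ContinuousOn (fun z ↦ √(G z w w)) (ball (extChartAt (𝓡 n) x₀ x₀) R) := by
      have : ContinuousOn G (ball (extChartAt (𝓡 n) x₀ x₀) R) :=
        hC.continuousOn.mono fun z hz ↦ (hball hz).1.1
      fun_prop
    refine h1.congr fun z hz ↦ ?_
    simp only [hsq z hz]
    exact (Real.sqrt_sq (norm_nonneg _)).symm

end Existence

end Geometry

/-! ### Semiconcavity of the squared distance -/

section SecondDifference

/-- Convexity of the square with weights `τ` and `1 - τ` at `p / τ` and `q / (1 - τ)`; equality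
holds when `p : q = τ : (1 - τ)`, as on a minimizing path. -/
lemma add_sq_le_div_add_div {p q τ : ℝ} (h0 : 0 < τ) (h1 : τ < 1) :
    (p + q) ^ 2 ≤ p ^ 2 / τ + q ^ 2 / (1 - τ) := by
  have h2 : 0 < 1 - τ := by linarith
  have h3 : p ^ 2 / τ + q ^ 2 / (1 - τ) - (p + q) ^ 2 =
      ((1 - τ) * p - τ * q) ^ 2 / (τ * (1 - τ)) := by
    field_simp
    ring
  have h4 : 0 ≤ ((1 - τ) * p - τ * q) ^ 2 / (τ * (1 - τ)) := by positivity
  linarith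

lemma one_add_mul_pow_four_le {β t : ℝ} (hβ : 0 ≤ β) (ht : 0 ≤ t) (ht' : t ≤ 1) :
    (1 + β * t) ^ 4 ≤ 1 + (1 + β) ^ 4 * t := by
  have h2 : t ^ 2 ≤ t := by nlinarith
  have h3 : t ^ 3 ≤ t := by nlinarith [mul_nonneg ht ht]
  have h4 : t ^ 4 ≤ t := by nlinarith [mul_nonneg ht (mul_nonneg ht ht)]
  nlinarith [mul_le_mul_of_nonneg_left h2 (pow_nonneg hβ 2),
    mul_le_mul_of_nonneg_left h3 (pow_nonneg hβ 3), mul_le_mul_of_nonneg_left h4 (pow_nonneg hβ 4)]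

/-- If `z` almost lies at the fraction `τ = s²` of a path of length `d`, then a comparison at the
scale `s²` of squared distances to `z` gives one for the squared distances to the endpoint. -/
lemma sum_sq_le_of_intermediate {d D s A₁ A₂ q C Y₁ Y₂ : ℝ} (hD : d ≤ D)
    (hs : 0 < s) (hs1 : s ≤ 1 / 2) (hq0 : 0 ≤ q) (hq : q ≤ (1 - s ^ 2) * d + s ^ 4)
    (hA : A₁ ^ 2 + A₂ ^ 2 ≤ 2 * (s ^ 2 * d) ^ 2 + C * s ^ 6) (hY₁ : 0 ≤ Y₁) (hY₂ : 0 ≤ Y₂)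
    (h₁ : Y₁ ≤ A₁ + q) (h₂ : Y₂ ≤ A₂ + q) :
    Y₁ ^ 2 + Y₂ ^ 2 - 2 * d ^ 2 ≤ (C + 4 * D + 4) * s ^ 4 := by
  have hτ0 : 0 < s ^ 2 := by positivity
  have hτ1 : s ^ 2 ≤ 1 / 4 := by nlinarith
  have e1 : Y₁ ^ 2 ≤ A₁ ^ 2 / s ^ 2 + q ^ 2 / (1 - s ^ 2) :=
    (pow_le_pow_left₀ hY₁ h₁ 2).trans (add_sq_le_div_add_div hτ0 (by linarith))
  have e2 : Y₂ ^ 2 ≤ A₂ ^ 2 / s ^ 2 + q ^ 2 / (1 - s ^ 2) :=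
    (pow_le_pow_left₀ hY₂ h₂ 2).trans (add_sq_le_div_add_div hτ0 (by linarith))
  -- Division by the weight `s²` turns the error `s⁶` into `s⁴`. The main terms here and in `e4` add
  -- up to `2 * d ^ 2`.
  have e3 : A₁ ^ 2 / s ^ 2 + A₂ ^ 2 / s ^ 2 ≤ 2 * s ^ 2 * d ^ 2 + C * s ^ 4 := by
    rw [← add_div, div_le_iff₀ hτ0]
    calc _ ≤ _ := hA
      _ = _ := by ring
  have e4 : q ^ 2 / (1 - s ^ 2) ≤ (1 - s ^ 2) * d ^ 2 + (2 * D + 2) * s ^ 4 := by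
    rw [div_le_iff₀ (by linarith)]
    have h5 : q ^ 2 ≤ ((1 - s ^ 2) * d + s ^ 4) ^ 2 := pow_le_pow_left₀ hq0 hq 2
    have h6 : d * s ^ 4 ≤ D * s ^ 4 := by gcongr
    have h7 : s ^ 4 * s ^ 4 ≤ s ^ 4 * 1 := by
      gcongr
      nlinarith
    have h8 : 0 ≤ s ^ 4 := by positivity
    have h9 : 0 ≤ (1 - s ^ 2 - 3 / 4) * s ^ 4 := mul_nonneg (by linarith) h8
    have h10 : (1 - s ^ 2) * (d * s ^ 4) ≤ (1 - s ^ 2) * (D * s ^ 4) :=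
      mul_le_mul_of_nonneg_left h6 (by linarith)
    nlinarith
  linarith

/-- Freezing the metric costs the factor `(1 + β s²)²` once in `A₁`, `A₂` and once in `c`, a
relative error `O(s²)` on a quantity `c² = O(s⁴)`; the other term `p²` is itself `O(s⁶)`. -/
lemma sum_sq_le_of_parallelogram {β s d D K A₁ A₂ c₁ c₂ c p : ℝ} (hβ : 0 ≤ β) (hs : 0 ≤ s)
    (hs1 : s ≤ 1) (hd : 0 ≤ d) (hD : d ≤ D) (hA₁ : 0 ≤ A₁) (hA₂ : 0 ≤ A₂) (hc : 0 ≤ c) (hp : 0 ≤ p)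
    (h₁ : A₁ ≤ (1 + β * s ^ 2) * c₁) (h₂ : A₂ ≤ (1 + β * s ^ 2) * c₂)
    (hpar : c₁ ^ 2 + c₂ ^ 2 = 2 * c ^ 2 + 2 * p ^ 2)
    (hcd : c ≤ (1 + β * s ^ 2) * (s ^ 2 * d)) (hpK : p ≤ K * s ^ 3) :
    A₁ ^ 2 + A₂ ^ 2 ≤ 2 * (s ^ 2 * d) ^ 2 +
      (2 * (1 + β) ^ 4 * D ^ 2 + 2 * (1 + (1 + β) ^ 4) * K ^ 2) * s ^ 6 := by
  have hτ0 : 0 ≤ s ^ 2 := by positivity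
  have hτ1 : s ^ 2 ≤ 1 := by nlinarith
  have e1 := pow_le_pow_left₀ hA₁ h₁ 2
  have e2 := pow_le_pow_left₀ hA₂ h₂ 2
  have e3 := pow_le_pow_left₀ hc hcd 2
  have e4 := pow_le_pow_left₀ hp hpK 2
  have e5 := one_add_mul_pow_four_le hβ hτ0 hτ1
  set B := (1 + β) ^ 4 with hB
  have hB0 : 0 ≤ B := by positivity
  have e6 : (1 + β * s ^ 2) ^ 2 ≤ 1 + B := by
    have : (1 + β * s ^ 2) ^ 2 ≤ (1 + β * s ^ 2) ^ 4 :=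
      pow_le_pow_right₀ (by linarith [mul_nonneg hβ hτ0]) (by norm_num)
    nlinarith
  have e7 : (s ^ 2 * d) ^ 2 ≤ (s ^ 2 * D) ^ 2 := pow_le_pow_left₀ (by positivity) (by gcongr) 2
  calc A₁ ^ 2 + A₂ ^ 2 ≤ (1 + β * s ^ 2) ^ 2 * (c₁ ^ 2 + c₂ ^ 2) := by linarith
    _ = (1 + β * s ^ 2) ^ 2 * (2 * c ^ 2) + (1 + β * s ^ 2) ^ 2 * (2 * p ^ 2) := by
        rw [hpar]; ring
    _ ≤ (1 + β * s ^ 2) ^ 2 * (2 * ((1 + β * s ^ 2) * (s ^ 2 * d)) ^ 2) +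
        (1 + B) * (2 * (K * s ^ 3) ^ 2) := by gcongr
    _ = (1 + β * s ^ 2) ^ 4 * (2 * (s ^ 2 * d) ^ 2) + 2 * (1 + B) * K ^ 2 * s ^ 6 := by ring
    _ ≤ (1 + B * s ^ 2) * (2 * (s ^ 2 * d) ^ 2) + 2 * (1 + B) * K ^ 2 * s ^ 6 := by gcongr
    _ = 2 * (s ^ 2 * d) ^ 2 + B * s ^ 2 * (2 * (s ^ 2 * d) ^ 2) +
        2 * (1 + B) * K ^ 2 * s ^ 6 := by ring
    _ ≤ 2 * (s ^ 2 * d) ^ 2 + B * s ^ 2 * (2 * (s ^ 2 * D) ^ 2) +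
        2 * (1 + B) * K ^ 2 * s ^ 6 := by gcongr
    _ = _ := by ring

variable {n : ℕ} {N : Type*} [MetricSpace N]
  [ChartedSpace (EuclideanSpace ℝ (Fin n)) N] [IsManifold (𝓡 n) ∞ N]
  [RiemannianBundle (fun x : N ↦ TangentSpace (𝓡 n) x)]

lemma chartNorm_parallelogram (x₀ : N) (a u v : EuclideanSpace ℝ (Fin n)) :
    chartNorm n x₀ a (u - v) ^ 2 + chartNorm n x₀ a (u + v) ^ 2 =
      2 * chartNorm n x₀ a u ^ 2 + 2 * chartNorm n x₀ a v ^ 2 := by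
  have := parallelogram_law_with_norm ℝ (frame n x₀ ((extChartAt (𝓡 n) x₀).symm a) u)
    (frame n x₀ ((extChartAt (𝓡 n) x₀).symm a) v)
  simp only [chartNorm, map_add, map_sub]
  linarith

variable [IsRiemannianManifold (𝓡 n) N]

set_option maxHeartbeats 800000 in
/-- The squared distance functions, read in a chart, are semiconcave with modulus `s ↦ s ^ (4 / 3)`,
uniformly for base points in a bounded set. -/
lemma ChartBound.exists_secondDiff_le {x₀ : N} {R K : ℝ} (h : ChartBound (n := n) x₀ R K) (D : ℝ) :
    ∃ r > 0, r ≤ R ∧ ∃ s₀ > 0, ∃ C ≥ 0, ∀ y, dist x₀ y ≤ D → ∀ a k : EuclideanSpace ℝ (Fin n),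
      ∀ s, 0 < s → s ≤ s₀ → ‖k‖ ≤ s ^ 3 → a ∈ ball (extChartAt (𝓡 n) x₀ x₀) r →
      a + k ∈ ball (extChartAt (𝓡 n) x₀ x₀) r → a - k ∈ ball (extChartAt (𝓡 n) x₀ x₀) r →
      dist ((extChartAt (𝓡 n) x₀).symm (a + k)) y ^ 2 +
        dist ((extChartAt (𝓡 n) x₀).symm (a - k)) y ^ 2 -
        2 * dist ((extChartAt (𝓡 n) x₀).symm a) y ^ 2 ≤ C * s ^ 4 := by
  obtain ⟨σ, hσ0, hσ⟩ := h.exists_ball_subset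
  have hK := h.one_le
  have hR := h.radius_pos
  by_cases hD0 : D < 0
  · exact ⟨R, hR, le_rfl, 1, one_pos, 0, le_rfl, fun y hy ↦ absurd (dist_nonneg.trans hy) (by simpa)⟩
  rw [not_lt] at hD0
  set D₁ := D + 1 with hD₁
  have hD₁0 : 0 < D₁ := by positivity
  set β := K * (K * D₁ + 1) with hβ
  have hβ0 : 0 ≤ β := by positivity
  set B := (1 + β) ^ 4 with hB
  have hB0 : 0 ≤ B := by positivity
  -- The radius `1 / K` puts the base point within 1 of `x₀`, whence `d ≤ D + 1`; the radius `σ / (2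
  -- * K)` puts it within `σ / 2`. The bound on `s` keeps the intermediate point, at distance `s²
  -- d`, in the remaining room.
  refine ⟨min R (min (1 / K) (σ / (2 * K))), by positivity, min_le_left _ _,
    min (1 / 2) (σ / (4 * D₁)), by positivity, (2 * B * D₁ ^ 2 + 2 * (1 + B) * K ^ 2) + 4 * D₁ + 4,
    by positivity, ?_⟩
  intro y hy a k s hs hs0 hk ha hak hak'
  have hs1 : s ≤ 1 / 2 := hs0.trans (min_le_left _ _)
  have hs2 : s * (4 * D₁) ≤ σ := by
    rw [← le_div_iff₀ (by positivity)]
    exact hs0.trans (min_le_right _ _)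
  have hsub : ball (extChartAt (𝓡 n) x₀ x₀) (min R (min (1 / K) (σ / (2 * K)))) ⊆
    ball (extChartAt (𝓡 n) x₀ x₀) R := ball_subset_ball (min_le_left _ _)
  have haR := hsub ha
  set P := (extChartAt (𝓡 n) x₀).symm with hP
  have hPe : ∀ z ∈ ball (extChartAt (𝓡 n) x₀ x₀) R, extChartAt (𝓡 n) x₀ (P z) = z :=
    fun z hz ↦ (extChartAt (𝓡 n) x₀).right_inv (h.ball_subset hz)
  have hdx : dist (P a) x₀ ≤ K * ‖a - extChartAt (𝓡 n) x₀ x₀‖ := by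
    have := h.dist_symm_le_norm (mem_ball_self hR) haR
    rwa [extChartAt_to_inv, dist_comm] at this
  have han : ‖a - extChartAt (𝓡 n) x₀ x₀‖ < min (1 / K) (σ / (2 * K)) := by
    rw [← dist_eq_norm]
    exact (mem_ball.1 ha).trans_le (min_le_right _ _)
  have hdx1 : dist (P a) x₀ ≤ 1 := by
    refine hdx.trans ?_
    have := (han.trans_le (min_le_left _ _)).le
    rw [le_div_iff₀ (by positivity)] at this
    linarith
  have hdx2 : dist (P a) x₀ < σ / 2 := by
    refine hdx.trans_lt ?_
    have := han.trans_le (min_le_right _ _)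
    rw [lt_div_iff₀ (by positivity)] at this
    linarith
  set d := dist (P a) y with hd
  have hd0 : 0 ≤ d := dist_nonneg
  have hdD : d ≤ D₁ := by linarith [dist_triangle (P a) x₀ y]
  have hτ : s ^ 2 ∈ Icc (0 : ℝ) 1 := ⟨by positivity, by nlinarith⟩
  -- The fraction `s²` balances the metric error `τ²` against `|k|² / τ` when `|k|` is of order
  -- `s³`; a defect `s⁴` in the length is harmless.
  obtain ⟨z, hz1, hz2⟩ := exists_dist_eq_mul n (P a) y hτ (by positivity : 0 < s ^ 4)
  rw [← hd] at hz1 hz2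
  have hsd : s ^ 2 * d ≤ s ^ 2 * D₁ := by gcongr
  have hsd' : 2 * (s ^ 2 * d) < σ / 2 := by nlinarith
  have hzσ : z ∈ ball x₀ σ := by
    rw [mem_ball]
    have := dist_triangle_left z x₀ (P a)
    nlinarith [mul_nonneg hτ.1 hd0]
  obtain ⟨hzs, hzR⟩ := hσ z hzσ
  set ζ := extChartAt (𝓡 n) x₀ z with hζ
  have hPζ : P ζ = z := (extChartAt (𝓡 n) x₀).left_inv (by simpa using hzs)
  have hζa : ‖ζ - a‖ ≤ K * (s ^ 2 * d) := by
    have := h.norm_extChartAt_sub_le hσ (x := P a) (x' := z)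
      (by rw [hz1]; nlinarith [mul_nonneg hτ.1 hd0])
    rwa [hPe a haR, hz1] at this
  have hs3 : s ^ 3 ≤ s ^ 2 := by nlinarith [sq_nonneg s]
  set ρ := (K * D₁ + 1) * s ^ 2 with hρ
  have hζρ : ‖ζ - a‖ ≤ ρ := by
    refine hζa.trans ?_
    have : K * (s ^ 2 * d) ≤ K * (s ^ 2 * D₁) := by gcongr
    rw [hρ]; nlinarith [sq_nonneg s]
  have hkρ : ‖k‖ ≤ ρ := by
    refine hk.trans (hs3.trans ?_)
    have : 0 ≤ K * D₁ * s ^ 2 := by positivity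
    rw [hρ]; linarith
  have hKρ : K * ρ = β * s ^ 2 := by rw [hρ, hβ]; ring
  have up1 : dist (P (a + k)) z ≤ (1 + β * s ^ 2) * chartNorm n x₀ a (ζ - (a + k)) := by
    rw [← hKρ, ← hPζ]
    exact h.dist_symm_le (hsub hak) hzR haR (by simpa using hkρ) hζρ
  have up2 : dist (P (a - k)) z ≤ (1 + β * s ^ 2) * chartNorm n x₀ a (ζ - (a - k)) := by
    rw [← hKρ, ← hPζ]
    exact h.dist_symm_le (hsub hak') hzR haR (by simpa using hkρ) hζρ
  have low : chartNorm n x₀ a (ζ - a) ≤ (1 + β * s ^ 2) * (s ^ 2 * d) := by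
    -- Here `ρ = 0`, since the metric is frozen at the coordinates of the starting point.
    have := h.chartNorm_extChartAt_sub_le hσ (x := P a) (x' := z) (a := a) (ρ := 0)
      (by rw [hz1]; linarith) haR (by rw [hPe a haR]; simp)
    rw [hPe a haR, hz1] at this
    refine this.trans ?_
    have h0 : 0 ≤ s ^ 2 * d := by positivity
    refine mul_le_mul_of_nonneg_right ?_ h0
    have : K * (K * (s ^ 2 * d)) ≤ K * (K * (s ^ 2 * D₁)) := by gcongr
    have : 0 ≤ K * s ^ 2 := by positivity
    rw [hβ]; nlinarith
  have par : chartNorm n x₀ a (ζ - (a + k)) ^ 2 + chartNorm n x₀ a (ζ - (a - k)) ^ 2 =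
      2 * chartNorm n x₀ a (ζ - a) ^ 2 + 2 * chartNorm n x₀ a k ^ 2 := by
    rw [show ζ - (a + k) = (ζ - a) - k by abel, show ζ - (a - k) = (ζ - a) + k by abel]
    exact chartNorm_parallelogram x₀ a (ζ - a) k
  have hkn : chartNorm n x₀ a k ≤ K * s ^ 3 := (h.chartNorm_le a haR k).trans (by gcongr)
  have hA := sum_sq_le_of_parallelogram hβ0 hs.le (by linarith) hd0 hdD dist_nonneg dist_nonneg
    (norm_nonneg _) (norm_nonneg _) up1 up2 par low hkn
  exact sum_sq_le_of_intermediate hdD hs hs1 dist_nonneg hz2 hA dist_nonneg dist_nonneg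
    (dist_triangle _ _ _) (dist_triangle _ _ _)

end SecondDifference

/-! ### Semiconvex functions and convergence of derivatives -/

section Semiconvex

variable {V : Type*} [NormedAddCommGroup V] [NormedSpace ℝ V]

/-- Lower bound for the second differences of `f` in a ball. -/
def SecondDiffGE (f : V → ℝ) (a₀ : V) (r s₀ C : ℝ) : Prop :=
  ∀ b k : V, ∀ s, 0 < s → s ≤ s₀ → ‖k‖ ≤ s ^ 3 → b ∈ ball a₀ r → b + k ∈ ball a₀ r →
    b - k ∈ ball a₀ r → -(C * s ^ 4) ≤ f (b + k) + f (b - k) - 2 * f b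

/-- The difference quotients at the dyadic scales `2⁻ʲ h` tend to `f' h`, and consecutive ones are
compared by a second difference at a midpoint. The errors form a convergent series because the
modulus `s⁴` is of higher order than the increment `s³`. -/
lemma SecondDiffGE.le_sub {f : V → ℝ} {a₀ a h : V} {r s₀ C s : ℝ} {f' : V →L[ℝ] ℝ}
    (H : SecondDiffGE f a₀ r s₀ C) (hC : 0 ≤ C) (hf : HasFDerivAt f f' a)
    (hs : 0 < s) (hs₀ : s ≤ s₀) (hh : ‖h‖ ≤ s ^ 3) (ha : a ∈ ball a₀ r) (hah : a + h ∈ ball a₀ r) :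
    f' h - 6 * C * s ^ 4 ≤ f (a + h) - f a := by
  set F : ℕ → ℝ := fun j ↦ (2 : ℝ) ^ j * (f (a + ((2 : ℝ) ^ j)⁻¹ • h) - f a) with hF
  have hmem : ∀ t ∈ Icc (0 : ℝ) 1, a + t • h ∈ ball a₀ r := fun t ht ↦ by
    have := (convex_ball a₀ r).add_smul_sub_mem ha hah ht
    simpa using this
  have hstep : ∀ j, F (j + 1) - C * (512 / 625) ^ j * s ^ 4 ≤ F j := by
    intro j
    have hp : (0 : ℝ) < 2 ^ j := by positivity
    set k := ((2 : ℝ) ^ (j + 1))⁻¹ • h with hk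
    have hkk : k + k = ((2 : ℝ) ^ j)⁻¹ • h := by
      rw [hk, ← add_smul]; congr 1; field_simp; ring
    -- The ratio `4/5` satisfies `(4/5)³ ≥ 1/2`, so the halved increments remain admissible, and `2
    -- * (4/5)⁴ = 512/625 < 1`, so the rescaled errors are summable.
    have hsj : 0 < (4 / 5 : ℝ) ^ (j + 1) * s := by positivity
    have hsj' : (4 / 5 : ℝ) ^ (j + 1) * s ≤ s₀ :=
      (mul_le_of_le_one_left hs.le (pow_le_one₀ (by norm_num) (by norm_num))).trans hs₀
    have hkn : ‖k‖ ≤ ((4 / 5 : ℝ) ^ (j + 1) * s) ^ 3 := by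
      rw [hk, norm_smul, norm_inv, norm_pow, Real.norm_ofNat, mul_pow, ← pow_mul, mul_comm _ 3,
        pow_mul, ← inv_pow]
      gcongr
      norm_num
    have hb1 : a + k ∈ ball a₀ r :=
      hmem _ ⟨by positivity, inv_le_one_of_one_le₀ (one_le_pow₀ (by norm_num))⟩
    have hb2 : a + k + k ∈ ball a₀ r := by
      rw [add_assoc, hkk]
      exact hmem _ ⟨by positivity, inv_le_one_of_one_le₀ (one_le_pow₀ (by norm_num))⟩
    have h2 := H (a + k) k _ hsj hsj' hkn hb1 hb2 (by simpa using ha)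
    rw [add_sub_cancel_right, add_assoc, hkk] at h2
    have h3 : C * ((4 / 5 : ℝ) ^ (j + 1) * s) ^ 4 * 2 ^ j ≤ C * (512 / 625) ^ j * s ^ 4 := by
      have : ((4 / 5 : ℝ) ^ (j + 1) * s) ^ 4 * 2 ^ j = (256 / 625) * ((512 / 625) ^ j * s ^ 4) := by
        rw [mul_pow, ← pow_mul, show (512 / 625 : ℝ) = (4 / 5) ^ 4 * 2 by norm_num, mul_pow,
          ← pow_mul]
        ring
      have h5 : 0 ≤ (512 / 625 : ℝ) ^ j * s ^ 4 := by positivity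
      rw [mul_assoc, this, mul_assoc]
      refine mul_le_mul_of_nonneg_left ?_ hC
      linarith
    simp only [hF]
    rw [← hk]
    have h4 := mul_le_mul_of_nonneg_left h2 hp.le
    rw [pow_succ]
    linarith
  -- The constant 6 exceeds the sum `625/113` of the geometric series.
  have hind : ∀ j, F j - 6 * C * s ^ 4 * (1 - (512 / 625) ^ j) ≤ F 0 := by
    intro j
    induction j with
    | zero => simp
    | succ j ih =>
      refine le_trans ?_ ih
      have h1 := hstep j
      have h2 : 0 ≤ C * s ^ 4 * (512 / 625) ^ j := by positivity
      rw [pow_succ (512 / 625 : ℝ) j]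
      linarith
  have hlim : Tendsto F atTop (𝓝 (f' h)) :=
    (hf.lim_real h).comp (tendsto_pow_atTop_atTop_of_one_lt (by norm_num : (1 : ℝ) < 2))
  have hlow : ∀ j, F j ≤ F 0 + 6 * C * s ^ 4 := fun j ↦ by
    have h1 := hind j
    have h2 : 0 ≤ 6 * C * s ^ 4 * (512 / 625) ^ j := by positivity
    linarith
  have := le_of_tendsto' hlim hlow
  simp only [hF, pow_zero, inv_one, one_smul, one_mul] at this
  linarith

/-- Uniform convergence of uniformly semiconvex functions forces the convergence of the
derivatives at a point where they exist. -/
lemma tendsto_fderiv_of_secondDiffGE {f : ℕ → V → ℝ} {g : V → ℝ} {a₀ a : V} {r s₀ C : ℝ}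
    {f' : ℕ → V →L[ℝ] ℝ} {g' : V →L[ℝ] ℝ} {ε : ℕ → ℝ} (hC : 0 ≤ C) (hs₀ : 0 < s₀)
    (H : ∀ k, SecondDiffGE (f k) a₀ r s₀ C) (hf : ∀ k, HasFDerivAt (f k) (f' k) a)
    (hg : HasFDerivAt g g' a) (ha : a ∈ ball a₀ r)
    (hε : ∀ k, ∀ z ∈ ball a₀ r, |f k z - g z| ≤ ε k) (hε0 : Tendsto ε atTop (𝓝 0)) :
    Tendsto f' atTop (𝓝 g') := by
  rw [Metric.tendsto_atTop]
  intro η hη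
  have h1 := hg.isLittleO.def (show 0 < η / 4 by positivity)
  have h1' : ∀ᶠ z in 𝓝 a, z ∈ ball a₀ r := isOpen_ball.mem_nhds ha
  obtain ⟨δ, hδ, hball⟩ := Metric.eventually_nhds_iff_ball.1 (h1.and h1')
  -- At increments of norm at most `s³`, the linearization of `g`, the semiconvexity error `6 C s⁴`
  -- and the uniform error `2 ε k` are each at most `(η / 4) s³`; `s` is fixed before `k`.
  obtain ⟨s, ⟨hsδ, hsC⟩, hs, hss₀⟩ : ∃ s, (s ^ 3 < δ ∧ 6 * C * s < η / 4) ∧ 0 < s ∧ s < s₀ := by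
    have t1 : Tendsto (fun s : ℝ ↦ s ^ 3) (𝓝[>] 0) (𝓝 0) := by
      have : Continuous fun s : ℝ ↦ s ^ 3 := by fun_prop
      simpa using (this.tendsto 0).mono_left nhdsWithin_le_nhds
    have t2 : Tendsto (fun s : ℝ ↦ 6 * C * s) (𝓝[>] 0) (𝓝 0) := by
      have : Continuous fun s : ℝ ↦ 6 * C * s := by fun_prop
      simpa using (this.tendsto 0).mono_left nhdsWithin_le_nhds
    exact (((t1.eventually_lt_const hδ).and (t2.eventually_lt_const (by positivity))).and
      (Ioo_mem_nhdsGT hs₀)).exists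
  have hs3 : 0 < s ^ 3 := by positivity
  obtain ⟨k₀, hk₀⟩ := (eventually_atTop.1 (hε0.eventually_lt_const
    (show 0 < s ^ 3 * (η / 8) by positivity)))
  refine ⟨k₀, fun k hk ↦ ?_⟩
  have hεk := hk₀ k hk
  -- A one-sided bound suffices, as it is used for both `u` and `-u`.
  have key : ∀ u : V, ‖u‖ ≤ 1 → (f' k - g') u ≤ 3 / 4 * η := by
    intro u hu
    have hn : ‖s ^ 3 • u‖ ≤ s ^ 3 := by
      rw [norm_smul, Real.norm_of_nonneg hs3.le]
      exact mul_le_of_le_one_right hs3.le hu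
    obtain ⟨hb1, hb2⟩ := hball (a + s ^ 3 • u)
      (by rw [mem_ball, dist_eq_norm, add_sub_cancel_left]; exact hn.trans_lt hsδ)
    have h2 := (H k).le_sub hC (hf k) hs hss₀.le hn ha hb2
    have h3 := abs_le.1 (hε k _ hb2)
    have h4 := abs_le.1 (hε k _ ha)
    rw [add_sub_cancel_left, Real.norm_eq_abs] at hb1
    have h5 := (abs_le.1 hb1).2
    have h6 : η / 4 * ‖s ^ 3 • u‖ ≤ η / 4 * s ^ 3 := by gcongr
    have h7 : f' k (s ^ 3 • u) - g' (s ^ 3 • u) ≤ s ^ 3 * (3 / 4 * η) := by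
      have : 6 * C * s * s ^ 3 ≤ η / 4 * s ^ 3 := by gcongr
      nlinarith
    rw [map_smul, map_smul, smul_eq_mul, smul_eq_mul, ← mul_sub] at h7
    exact le_of_mul_le_mul_left h7 hs3
  rw [dist_eq_norm]
  refine lt_of_le_of_lt (ContinuousLinearMap.opNorm_le_of_unit_norm (C := 3 / 4 * η)
    (by positivity) fun u hu ↦ ?_) (by linarith)
  rw [Real.norm_eq_abs, abs_le]
  have h1 := key u hu.le
  have h2 := key (-u) (by rw [norm_neg]; exact hu.le)
  rw [map_neg] at h2
  exact ⟨by linarith, h1⟩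

end Semiconvex

/-! ### Points of density -/

section Density

open scoped Pointwise in
/-- Almost every point of a measurable set is a point of unique differentiability. -/
lemma ae_uniqueDiffWithinAt {V : Type*} [NormedAddCommGroup V] [NormedSpace ℝ V]
    [FiniteDimensional ℝ V] [MeasurableSpace V] [BorelSpace V] (μ : Measure V)
    [μ.IsAddHaarMeasure] {s : Set V} (hs : MeasurableSet s) :
    ∀ᵐ x ∂μ, x ∈ s → UniqueDiffWithinAt ℝ s x := by
  rw [← ae_restrict_iff' hs]
  filter_upwards [Besicovitch.ae_tendsto_measure_inter_div μ s, ae_restrict_mem hs] with x hx xs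
  -- At a density point, `s` meets `x + r B` for every closed ball `B` of positive radius and all
  -- small `r > 0`. With balls shrinking to `z`, this makes `z` a tangent direction.
  have hcone : tangentConeAt ℝ s x = univ := by
    refine eq_univ_of_forall fun z ↦ ?_
    have h1 : ∀ k : ℕ, ∃ r : ℝ, ∃ a : V, 0 < r ∧ r < 1 / ((k : ℝ) + 1) ∧
        dist a z ≤ 1 / ((k : ℝ) + 1) ∧ x + r • a ∈ s := by
      intro k
      have hk : 0 < 1 / ((k : ℝ) + 1) := by positivity
      have B₁ : ∀ᶠ r in 𝓝[>] (0 : ℝ),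
          (s ∩ ({x} + r • closedBall z (1 / ((k : ℝ) + 1)))).Nonempty :=
        Measure.eventually_nonempty_inter_smul_of_density_one μ s x hx _ measurableSet_closedBall
          (measure_closedBall_pos μ z hk).ne'
      obtain ⟨r, ⟨y, ys, hy⟩, hr⟩ := (B₁.and (Ioo_mem_nhdsGT hk)).exists
      simp only [mem_smul_set, image_add_left, mem_preimage, singleton_add] at hy
      obtain ⟨a, az, ha⟩ := hy
      refine ⟨r, a, hr.1, hr.2, az, ?_⟩
      rwa [show x + r • a = y by simp only [ha, add_neg_cancel_left]]
    choose r a hr hr' ha has using h1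
    have hlim : Tendsto (fun k : ℕ ↦ 1 / ((k : ℝ) + 1)) atTop (𝓝 0) :=
      tendsto_one_div_add_atTop_nhds_zero_nat
    have hr0 : Tendsto r atTop (𝓝 0) :=
      squeeze_zero (fun k ↦ (hr k).le) (fun k ↦ (hr' k).le) hlim
    have ha0 : Tendsto a atTop (𝓝 z) :=
      tendsto_iff_dist_tendsto_zero.2 (squeeze_zero (fun _ ↦ dist_nonneg) ha hlim)
    refine mem_tangentConeAt_of_seq atTop (fun k ↦ (r k)⁻¹) (fun k ↦ r k • a k) ?_
      (Eventually.of_forall has) ?_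
    · simpa using hr0.smul ha0
    · refine ha0.congr fun k ↦ ?_
      rw [inv_smul_smul₀ (hr k).ne']
  refine ⟨?_, subset_closure xs⟩
  rw [hcone]
  simp

end Density

/-! ### Null sets of the Riemannian volume -/

section NullSets

variable {n : ℕ} {N : Type*} [MetricSpace N] [ChartedSpace (EuclideanSpace ℝ (Fin n)) N]
  [RiemannianBundle (fun x : N ↦ TangentSpace (𝓡 n) x)] [MeasurableSpace N]

/-- A supremum of measures is not computed set by set. However, each `μ i` is carried by `sᶜ`, so
the restriction of the supremum to `sᶜ` is already an upper bound. -/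
lemma iSup_measure_eq_zero {α : Type*} {ι : Sort*} [MeasurableSpace α] {μ : ι → Measure α} {s : Set α}
    (hs : MeasurableSet s) (h : ∀ i, μ i s = 0) : (⨆ i, μ i) s = 0 := by
  have h1 : (⨆ i, μ i) ≤ (⨆ i, μ i).restrict sᶜ := by
    refine iSup_le fun i ↦ ?_
    have h2 : (μ i).restrict sᶜ = μ i := by
      rw [Measure.restrict_eq_self_of_ae_mem]
      exact measure_eq_zero_iff_ae_notMem.1 (h i)
    calc μ i = (μ i).restrict sᶜ := h2.symm
      _ ≤ _ := Measure.restrict_mono le_rfl (le_iSup μ i)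
  have h3 := h1 s
  rw [Measure.restrict_apply hs, inter_compl_self, measure_empty] at h3
  exact le_antisymm h3 bot_le

lemma riemannianVolume_eq_zero {S : Set N} (hS : MeasurableSet S)
    (h : ∀ e ∈ atlas (EuclideanSpace ℝ (Fin n)) N, chartVolume (n := n) e S = 0) :
    riemannianVolume n N S = 0 := by
  rw [riemannianVolume]
  exact iSup_measure_eq_zero hS fun e ↦ iSup_measure_eq_zero hS fun he ↦ h e he

variable [IsManifold (𝓡 n) ∞ N]

lemma measurableSet_source_inter_preimage {α β : Type*} [TopologicalSpace α] [MeasurableSpace α]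
    [OpensMeasurableSpace α] [TopologicalSpace β] [MeasurableSpace β] [BorelSpace β]
    (c : OpenPartialHomeomorph α β) {T : Set β} (hT : MeasurableSet T) :
    MeasurableSet (c.source ∩ c ⁻¹' T) := by
  have h1 : Measurable (c.source.domRestrict c) := c.continuousOn.domRestrict.measurable
  have h2 : c.source ∩ c ⁻¹' T = Subtype.val '' (c.source.domRestrict c ⁻¹' T) := by
    rw [domRestrict_eq, preimage_comp, Subtype.image_preimage_coe]
  rw [h2]
  exact c.open_source.measurableSet.subtype_image (h1 hT)

/-- Read in the chart `e`, the set lies in the image of part of `T` under a transition map, which is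
differentiable and so preserves null sets. -/
lemma chartVolume_preimage_eq_zero (x₀ : N)
    {e : OpenPartialHomeomorph N (EuclideanSpace ℝ (Fin n))}
    (he : e ∈ atlas (EuclideanSpace ℝ (Fin n)) N) {T : Set (EuclideanSpace ℝ (Fin n))}
    (hT : volume T = 0)
    (hS : MeasurableSet ((chartAt (EuclideanSpace ℝ (Fin n)) x₀).source ∩
      chartAt (EuclideanSpace ℝ (Fin n)) x₀ ⁻¹' T)) :
    chartVolume e ((chartAt (EuclideanSpace ℝ (Fin n)) x₀).source ∩
      chartAt (EuclideanSpace ℝ (Fin n)) x₀ ⁻¹' T) = 0 := by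
  set c := chartAt (EuclideanSpace ℝ (Fin n)) x₀ with hc
  set S := c.source ∩ c ⁻¹' T with hSdef
  rw [chartVolume]
  by_cases hm : AEMeasurable e.symm (((volume : Measure (EuclideanSpace ℝ (Fin n))).restrict
    e.target).withDensity fun y ↦ ENNReal.ofReal (√(metricMatrix e y).det))
  swap
  -- By convention `Measure.map` is zero in this case.
  · rw [Measure.map_of_not_aemeasurable hm]; simp
  rw [Measure.map_apply_of_aemeasurable hm hS]
  refine withDensity_absolutelyContinuous _ _ ?_
  rw [Measure.restrict_apply₀' e.open_target.measurableSet.nullMeasurableSet]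
  have hdiff : DifferentiableOn ℝ (e ∘ c.symm) (c.target ∩ c.symm ⁻¹' e.source) := by
    have h1 : MDifferentiableOn (𝓡 n) (𝓡 n) c.symm c.target :=
      (mdifferentiable_chart (I := 𝓡 n) x₀).2
    have h2 : MDifferentiableOn (𝓡 n) (𝓡 n) e e.source :=
      (mdifferentiable_of_mem_atlas (I := 𝓡 n) he).1
    have h3 : MDifferentiableOn (𝓡 n) (𝓡 n) (e ∘ c.symm) (c.target ∩ c.symm ⁻¹' e.source) :=
      h2.comp (h1.mono inter_subset_left) inter_subset_right
    exact mdifferentiableOn_iff_differentiableOn.1 h3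
  have himg := addHaar_image_eq_zero_of_differentiableOn_of_addHaar_eq_zero volume
    (hdiff.mono (inter_subset_right (s := T)))
    (measure_mono_null inter_subset_left hT)
  refine measure_mono_null ?_ himg
  rintro z ⟨⟨hz1, hz2⟩, hz3⟩
  refine ⟨c (e.symm z), ⟨hz2, c.map_source hz1, ?_⟩, ?_⟩
  · rw [mem_preimage, c.left_inv hz1]; exact e.map_target hz3
  · simp only [Function.comp]
    rw [c.left_inv hz1, e.right_inv hz3]

/-- A measure that is absolutely continuous with respect to the Riemannian volume does not charge
the sets that are null in a chart. -/
lemma measure_chart_preimage_eq_zero [BorelSpace N] {m : Measure N} (hac : m ≪ riemannianVolume n N) (x₀ : N)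
    {T : Set (EuclideanSpace ℝ (Fin n))} (hT : volume T = 0) :
    m ((chartAt (EuclideanSpace ℝ (Fin n)) x₀).source ∩ extChartAt (𝓡 n) x₀ ⁻¹' T) = 0 := by
  set c := chartAt (EuclideanSpace ℝ (Fin n)) x₀ with hc
  have hT' : volume (toMeasurable volume T) = 0 := by rwa [measure_toMeasurable]
  have hmeas := measurableSet_source_inter_preimage c (measurableSet_toMeasurable volume T)
  have hsub : c.source ∩ extChartAt (𝓡 n) x₀ ⁻¹' T ⊆
      c.source ∩ c ⁻¹' (toMeasurable volume T) := by
    rintro x ⟨hx1, hx2⟩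
    exact ⟨hx1, subset_toMeasurable _ _ (by simpa using hx2)⟩
  refine measure_mono_null hsub (hac ?_)
  exact riemannianVolume_eq_zero hmeas fun e he ↦ chartVolume_preimage_eq_zero x₀ he hT' hmeas

end NullSets

/-! ### Gradients along `M` in coordinates -/

section Gradient

variable {n : ℕ} {N : Type*} [MetricSpace N] [ChartedSpace (EuclideanSpace ℝ (Fin n)) N]
  [IsManifold (𝓡 n) ∞ N]

lemma uniqueMDiffWithinAt_of_chart {M : Set N} {x₀ x : N}
    (hx : x ∈ (chartAt (EuclideanSpace ℝ (Fin n)) x₀).source)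
    (h : UniqueDiffWithinAt ℝ ((extChartAt (𝓡 n) x₀).target ∩ (extChartAt (𝓡 n) x₀).symm ⁻¹' M)
      (extChartAt (𝓡 n) x₀ x)) : UniqueMDiffWithinAt (𝓡 n) M x := by
  set c := chartAt (EuclideanSpace ℝ (Fin n)) x₀ with hc
  have h1 : UniqueMDiffWithinAt (𝓡 n) (c.target ∩ c.symm ⁻¹' M) (c x) := by
    have := uniqueMDiffWithinAt_iff_uniqueDiffWithinAt.2 h
    simpa using this
  have h2 := h1.preimage_openPartialHomeomorph (e := c.symm)
    (mdifferentiable_chart (I := 𝓡 n) x₀).symm (by simpa using c.map_source hx)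
  rw [c.left_inv hx] at h2
  refine h2.mono fun y hy ↦ ?_
  have hy1 : y ∈ c.source := hy.1
  have hy2 : c.symm (c y) ∈ M := by simpa using hy.2.2
  rwa [c.left_inv hy1] at hy2

variable [RiemannianBundle (fun x : N ↦ TangentSpace (𝓡 n) x)]

/-- The gradient of a function that is represented by `V` in the preferred chart at `x₀`. -/
lemma hasGradAt_and_inner_grad {M : Set N} {u : M → ℝ} {x₀ x : N}
    {V : EuclideanSpace ℝ (Fin n) → ℝ} {ℓ : EuclideanSpace ℝ (Fin n) →L[ℝ] ℝ} (hxM : x ∈ M)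
    (hx : x ∈ (chartAt (EuclideanSpace ℝ (Fin n)) x₀).source)
    (hV : HasFDerivAt V ℓ (extChartAt (𝓡 n) x₀ x))
    (heq : ∀ᶠ y in 𝓝[M] x, extendZero M u y = V (extChartAt (𝓡 n) x₀ y))
    (hu : UniqueDiffWithinAt ℝ ((extChartAt (𝓡 n) x₀).target ∩ (extChartAt (𝓡 n) x₀).symm ⁻¹' M)
      (extChartAt (𝓡 n) x₀ x)) :
    (∃ v, HasGradAt n M u x v) ∧ ∀ w, inner ℝ (grad n M u x) (frame n x₀ x w) = ℓ w := by
  have hfd : FiniteDimensional ℝ (TangentSpace (𝓡 n) x) :=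
    inferInstanceAs (FiniteDimensional ℝ (EuclideanSpace ℝ (Fin n)))
  have hcs : CompleteSpace (TangentSpace (𝓡 n) x) := FiniteDimensional.complete ℝ _
  have h1 : HasMFDerivWithinAt (𝓡 n) 𝓘(ℝ, ℝ) (extendZero M u) M x (ℓ ∘L coframe n x₀ x) := by
    have h2 : HasMFDerivAt (𝓡 n) 𝓘(ℝ, EuclideanSpace ℝ (Fin n)) (extChartAt (𝓡 n) x₀) x
        (coframe n x₀ x) := by
      rw [← mfderiv_extChartAt_eq_coframe hx]
      exact (mdifferentiableAt_extChartAt hx).hasMFDerivAt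
    have h3 : HasMFDerivAt 𝓘(ℝ, EuclideanSpace ℝ (Fin n)) 𝓘(ℝ, ℝ) V (extChartAt (𝓡 n) x₀ x) ℓ :=
      hV.hasMFDerivAt
    have h4 := (h3.comp x h2).hasMFDerivWithinAt (s := M)
    exact h4.congr_of_eventuallyEq heq (heq.self_of_nhdsWithin hxM)
  have hex : ∃ v, HasGradAt n M u x v := by
    refine ⟨(InnerProductSpace.toDual ℝ (TangentSpace (𝓡 n) x)).symm (ℓ ∘L coframe n x₀ x), ?_⟩
    rw [HasGradAt]
    have h2 : innerSL ℝ ((InnerProductSpace.toDual ℝ (TangentSpace (𝓡 n) x)).symm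
        (ℓ ∘L coframe n x₀ x)) = ℓ ∘L coframe n x₀ x := by
      ext w
      simp
    rw [h2]
    exact h1
  refine ⟨hex, fun w ↦ ?_⟩
  have h2 : HasGradAt n M u x (grad n M u x) := by
    rw [grad, dif_pos hex]
    exact hex.choose_spec
  -- `grad` is an arbitrary choice; unique differentiability of `M` at `x` identifies it with the
  -- gradient read in the chart.
  have h3 := (uniqueMDiffWithinAt_of_chart hx hu).eq h2 h1
  have h4 : innerSL ℝ (grad n M u x) (frame n x₀ x w) = ℓ (coframe n x₀ x (frame n x₀ x w)) :=
    DFunLike.congr_fun h3 (frame n x₀ x w)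
  rwa [coframe_frame hx] at h4

end Gradient

/-! ### Gradients of Lipschitz functions -/

section LipschitzGradient

lemma extendZero_of_mem {N : Type*} [MetricSpace N] {M : Set N} (u : M → ℝ) {x : N} (hx : x ∈ M) :
    extendZero M u x = u ⟨x, hx⟩ :=
  Subtype.val_injective.extend_apply u 0 ⟨x, hx⟩

variable {n : ℕ} {N : Type*} [MetricSpace N] [ChartedSpace (EuclideanSpace ℝ (Fin n)) N]

variable (n) in
lemma exists_null_uniqueDiffWithinAt {M : Set N} (hM : IsClosed M) (x₀ : N) :
    ∃ T : Set (EuclideanSpace ℝ (Fin n)), volume T = 0 ∧ ∀ x ∈ M,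
      x ∈ (chartAt (EuclideanSpace ℝ (Fin n)) x₀).source → extChartAt (𝓡 n) x₀ x ∉ T →
      UniqueDiffWithinAt ℝ ((extChartAt (𝓡 n) x₀).target ∩ (extChartAt (𝓡 n) x₀).symm ⁻¹' M)
        (extChartAt (𝓡 n) x₀ x) := by
  have hmeas : MeasurableSet
      ((extChartAt (𝓡 n) x₀).target ∩ (extChartAt (𝓡 n) x₀).symm ⁻¹' M) := by
    borelize N
    simpa using measurableSet_source_inter_preimage
      (chartAt (EuclideanSpace ℝ (Fin n)) x₀).symm hM.measurableSet
  refine ⟨_, ae_iff.1 (ae_uniqueDiffWithinAt volume hmeas), fun x hxM hx hT ↦ ?_⟩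
  simp only [mem_ofPred_eq, not_not] at hT
  refine hT ⟨(extChartAt (𝓡 n) x₀).map_source (by simpa using hx), ?_⟩
  rw [mem_preimage, (extChartAt (𝓡 n) x₀).left_inv (by simpa using hx)]
  exact hxM

variable [IsManifold (𝓡 n) ∞ N] [RiemannianBundle (fun x : N ↦ TangentSpace (𝓡 n) x)]

/-- Testing on the coordinates of `v` itself gives `‖v‖ ^ 2 = ℓ (coframe n x₀ x v)`. -/
lemma ChartBound.norm_le_of_inner_frame {x₀ x : N} {R K : ℝ} (h : ChartBound (n := n) x₀ R K)
    (hx : x ∈ (chartAt (EuclideanSpace ℝ (Fin n)) x₀).source)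
    (hxR : extChartAt (𝓡 n) x₀ x ∈ ball (extChartAt (𝓡 n) x₀ x₀) R) {v : TangentSpace (𝓡 n) x}
    {ℓ : EuclideanSpace ℝ (Fin n) →L[ℝ] ℝ} (hv : ∀ w, inner ℝ v (frame n x₀ x w) = ℓ w) :
    ‖v‖ ≤ K * ‖ℓ‖ := by
  have h1 := hv (coframe n x₀ x v)
  rw [frame_coframe hx, real_inner_self_eq_norm_sq] at h1
  have h2 : ‖coframe n x₀ x v‖ ≤ K * ‖v‖ := by
    have := h.le_chartNorm _ hxR (coframe n x₀ x v)
    rwa [chartNorm_extChartAt hx, frame_coframe hx] at this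
  have hK := h.one_le
  have h3 : ‖v‖ ^ 2 ≤ K * ‖ℓ‖ * ‖v‖ := by
    calc ‖v‖ ^ 2 = ℓ (coframe n x₀ x v) := h1
      _ ≤ ‖ℓ (coframe n x₀ x v)‖ := Real.le_norm_self _
      _ ≤ ‖ℓ‖ * ‖coframe n x₀ x v‖ := ℓ.le_opNorm _
      _ ≤ ‖ℓ‖ * (K * ‖v‖) := by gcongr
      _ = _ := by ring
  rcases (norm_nonneg v).eq_or_lt with h0 | h0
  · rw [← h0]; positivity
  · rw [sq] at h3
    exact le_of_mul_le_mul_right h3 h0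

/-- The length of a tangent vector as a countable supremum. -/
lemma enorm_eq_iSup_of_inner_frame {x₀ x : N}
    (hx : x ∈ (chartAt (EuclideanSpace ℝ (Fin n)) x₀).source) {v : TangentSpace (𝓡 n) x}
    {ℓ : EuclideanSpace ℝ (Fin n) →L[ℝ] ℝ} (hv : ∀ w, inner ℝ v (frame n x₀ x w) = ℓ w) :
    ‖v‖ₑ = ⨆ k : ℕ, ENNReal.ofReal
      (|ℓ (TopologicalSpace.denseSeq (EuclideanSpace ℝ (Fin n)) k)| /
        ‖frame n x₀ x (TopologicalSpace.denseSeq (EuclideanSpace ℝ (Fin n)) k)‖) := by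
  refine le_antisymm ?_ (iSup_le fun k ↦ ?_)
  · refine le_of_forall_lt fun c hc ↦ ?_
    -- The quotient equals `‖v‖` at `w₀` and is continuous there, so a dense sequence comes as close
    -- as desired.
    set w₀ := coframe n x₀ x v with hw₀
    have hv0 : ‖v‖ ≠ 0 := by
      intro h0
      rw [← ofReal_norm, h0] at hc
      simp at hc
    have hw : frame n x₀ x w₀ = v := frame_coframe hx v
    have hval : |ℓ w₀| / ‖frame n x₀ x w₀‖ = ‖v‖ := by
      rw [← hv w₀, hw, real_inner_self_eq_norm_sq, abs_of_nonneg (sq_nonneg _), sq,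
        mul_div_assoc, div_self hv0, mul_one]
    have hcont : ContinuousAt (fun w ↦ ENNReal.ofReal (|ℓ w| / ‖frame n x₀ x w‖)) w₀ := by
      refine ENNReal.continuous_ofReal.continuousAt.comp ?_
      refine ContinuousAt.div ℓ.continuous.abs.continuousAt
        ((frame n x₀ x).continuous.norm.continuousAt) ?_
      rwa [hw]
    have hev : ∀ᶠ w in 𝓝 w₀, c < ENNReal.ofReal (|ℓ w| / ‖frame n x₀ x w‖) := by
      refine hcont.eventually_const_lt ?_
      change c < ENNReal.ofReal (|ℓ w₀| / ‖frame n x₀ x w₀‖)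
      rwa [hval, ofReal_norm]
    obtain ⟨k, hk⟩ := (TopologicalSpace.denseRange_denseSeq
      (EuclideanSpace ℝ (Fin n))).exists_mem_open isOpen_interior ⟨w₀, mem_interior_iff_mem_nhds.2 hev⟩
    exact (interior_subset hk).trans_le (le_iSup (fun k : ℕ ↦ ENNReal.ofReal
      (|ℓ (TopologicalSpace.denseSeq (EuclideanSpace ℝ (Fin n)) k)| /
        ‖frame n x₀ x (TopologicalSpace.denseSeq (EuclideanSpace ℝ (Fin n)) k)‖)) k)
  · rw [← ofReal_norm]
    refine ENNReal.ofReal_le_ofReal (div_le_of_le_mul₀ (norm_nonneg _) (norm_nonneg _) ?_)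
    rw [← hv]
    exact abs_real_inner_le_norm _ _

variable [IsRiemannianManifold (𝓡 n) N]

/-- A Lipschitz function is represented, near a point, by a Lipschitz function on the model space,
whose derivative represents the gradient almost everywhere. -/
lemma ChartBound.exists_lipschitz_repr {x₀ : N} {R K : ℝ} (h : ChartBound (n := n) x₀ R K)
    {M : Set N} (hM : IsClosed M) {u : M → ℝ} {C : ℝ≥0} (hu : LipschitzWith C u) :
    ∃ V : EuclideanSpace ℝ (Fin n) → ℝ, LipschitzWith (C * K.toNNReal) V ∧
      ∃ T : Set (EuclideanSpace ℝ (Fin n)), volume T = 0 ∧ ∀ x ∈ M,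
        x ∈ (chartAt (EuclideanSpace ℝ (Fin n)) x₀).source →
        extChartAt (𝓡 n) x₀ x ∈ ball (extChartAt (𝓡 n) x₀ x₀) R → extChartAt (𝓡 n) x₀ x ∉ T →
        (∃ v, HasGradAt n M u x v) ∧
          ∀ w, inner ℝ (grad n M u x) (frame n x₀ x w) = fderiv ℝ V (extChartAt (𝓡 n) x₀ x) w := by
  have hK := h.one_le
  set S := ball (extChartAt (𝓡 n) x₀ x₀) R ∩ (extChartAt (𝓡 n) x₀).symm ⁻¹' M with hS
  have hlip : LipschitzOnWith (C * K.toNNReal) (extendZero M u ∘ (extChartAt (𝓡 n) x₀).symm) S := by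
    refine LipschitzOnWith.of_dist_le_mul fun z hz z' hz' ↦ ?_
    simp only [Function.comp]
    rw [extendZero_of_mem u hz.2, extendZero_of_mem u hz'.2, NNReal.coe_mul,
      Real.coe_toNNReal _ (by positivity), mul_assoc]
    refine (hu.dist_le_mul _ _).trans ?_
    refine mul_le_mul_of_nonneg_left ?_ C.2
    rw [dist_comm z, dist_eq_norm]
    exact h.dist_symm_le_norm hz.1 hz'.1
  -- The Lipschitz extension to the whole model space makes Rademacher's theorem available; the
  -- exceptional set also contains the points where `M` fails to determine differentials.
  obtain ⟨V, hV, hVeq⟩ := hlip.extend_real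
  obtain ⟨T, hT, hTu⟩ := exists_null_uniqueDiffWithinAt n hM x₀
  refine ⟨V, hV, T ∪ {z | ¬ DifferentiableAt ℝ V z},
    measure_union_null hT (ae_iff.1 hV.ae_differentiableAt), fun x hxM hx hxR hxT ↦ ?_⟩
  simp only [mem_union, mem_ofPred_eq, not_or, not_not] at hxT
  refine hasGradAt_and_inner_grad hxM hx hxT.2.hasFDerivAt ?_ (hTu x hxM hx hxT.1)
  have h1 : ∀ᶠ y in 𝓝 x, y ∈ (chartAt (EuclideanSpace ℝ (Fin n)) x₀).source ∧
      extChartAt (𝓡 n) x₀ y ∈ ball (extChartAt (𝓡 n) x₀ x₀) R :=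
    Filter.Eventually.and ((chartAt (EuclideanSpace ℝ (Fin n)) x₀).open_source.mem_nhds hx)
      ((continuousAt_extChartAt' (I := 𝓡 n) (by simpa using hx)).preimage_mem_nhds
        (isOpen_ball.mem_nhds hxR))
  filter_upwards [nhdsWithin_le_nhds h1, self_mem_nhdsWithin] with y hy hyM
  have hleft : (extChartAt (𝓡 n) x₀).symm (extChartAt (𝓡 n) x₀ y) = y :=
    (extChartAt (𝓡 n) x₀).left_inv (by simpa using hy.1)
  rw [← hVeq (show extChartAt (𝓡 n) x₀ y ∈ S from ⟨hy.2, by rwa [mem_preimage, hleft]⟩)]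
  simp only [Function.comp]
  rw [hleft]

end LipschitzGradient

/-! ### Lipschitz functions lie in `H¹` -/

section LipschitzH1

variable {n : ℕ} {N : Type*} [MetricSpace N] [ChartedSpace (EuclideanSpace ℝ (Fin n)) N]

variable (n) in
/-- The set of points whose coordinates in the preferred chart at `x₀` are at distance less
than `R` from those of `x₀`. -/
def chartBall (x₀ : N) (R : ℝ) : Set N :=
  (chartAt (EuclideanSpace ℝ (Fin n)) x₀).source ∩
    extChartAt (𝓡 n) x₀ ⁻¹' ball (extChartAt (𝓡 n) x₀ x₀) R

lemma isOpen_chartBall (x₀ : N) (R : ℝ) : IsOpen (chartBall n x₀ R) := by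
  have := (continuousOn_extChartAt (I := 𝓡 n) x₀).isOpen_inter_preimage
    (isOpen_extChartAt_source x₀) (isOpen_ball (x := extChartAt (𝓡 n) x₀ x₀) (ε := R))
  rwa [extChartAt_source] at this

lemma chartBall_mem_nhds (x₀ : N) {R : ℝ} (hR : 0 < R) : chartBall n x₀ R ∈ 𝓝 x₀ :=
  (isOpen_chartBall x₀ R).mem_nhds ⟨mem_chart_source _ x₀, mem_ball_self hR⟩

variable [IsManifold (𝓡 n) ∞ N] [RiemannianBundle (fun x : N ↦ TangentSpace (𝓡 n) x)]
  [MeasurableSpace N] [BorelSpace N]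

lemma ae_extChartAt_notMem {m : Measure N} (hac : m ≪ riemannianVolume n N) (x₀ : N)
    {T : Set (EuclideanSpace ℝ (Fin n))} (hT : volume T = 0) :
    ∀ᵐ x ∂m, x ∈ (chartAt (EuclideanSpace ℝ (Fin n)) x₀).source → extChartAt (𝓡 n) x₀ x ∉ T := by
  filter_upwards [measure_eq_zero_iff_ae_notMem.1 (measure_chart_preimage_eq_zero hac x₀ hT)]
    with x hx hxs hxT
  exact hx ⟨hxs, hxT⟩

variable [IsContMDiffRiemannianBundle (𝓡 n) ∞ (EuclideanSpace ℝ (Fin n))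
      (fun x : N ↦ TangentSpace (𝓡 n) x)] [IsRiemannianManifold (𝓡 n) N]

/-- Lipschitz functions have a gradient almost everywhere, bounded in terms of the Lipschitz
constant. -/
lemma exists_grad_bound {M : Set N} (hM : IsCompact M) {m : Measure N}
    (hac : m ≪ riemannianVolume n N) :
    ∃ B : ℝ≥0, ∀ (u : M → ℝ) (C : ℝ≥0), LipschitzWith C u →
      ∀ᵐ x ∂m, x ∈ M → (∃ v, HasGradAt n M u x v) ∧ ‖grad n M u x‖ₑ ≤ C * B := by
  -- The membership `x ∈ M` is doubled so that one copy can become `x ∈ s` in the induction over the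
  -- compact set.
  suffices H : ∃ B : ℝ≥0, ∀ (u : M → ℝ) (C : ℝ≥0), LipschitzWith C u →
      ∀ᵐ x ∂m, x ∈ M → x ∈ M → (∃ v, HasGradAt n M u x v) ∧ ‖grad n M u x‖ₑ ≤ C * B by
    obtain ⟨B, hB⟩ := H
    exact ⟨B, fun u C hu ↦ (hB u C hu).mono fun x hx hxM ↦ hx hxM hxM⟩
  refine hM.induction_on (p := fun s ↦ ∃ B : ℝ≥0, ∀ (u : M → ℝ) (C : ℝ≥0), LipschitzWith C u →
    ∀ᵐ x ∂m, x ∈ M → x ∈ s → (∃ v, HasGradAt n M u x v) ∧ ‖grad n M u x‖ₑ ≤ C * B) ?_ ?_ ?_ ?_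
  · exact ⟨0, fun u C _ ↦ ae_of_all _ fun x _ hx ↦ absurd hx (notMem_empty x)⟩
  · rintro s t hst ⟨B, hB⟩
    exact ⟨B, fun u C hu ↦ (hB u C hu).mono fun x hx hxM hxs ↦ hx hxM (hst hxs)⟩
  · rintro s t ⟨B, hB⟩ ⟨B', hB'⟩
    refine ⟨max B B', fun u C hu ↦ ?_⟩
    filter_upwards [hB u C hu, hB' u C hu] with x hx hx' hxM hxst
    rcases hxst with hxs | hxt
    · exact ⟨(hx hxM hxs).1, (hx hxM hxs).2.trans (by gcongr; exact le_max_left _ _)⟩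
    · exact ⟨(hx' hxM hxt).1, (hx' hxM hxt).2.trans (by gcongr; exact le_max_right _ _)⟩
  · intro x₀ _
    obtain ⟨R, K, h⟩ := exists_chartBound (n := n) x₀
    have hK : 0 ≤ K := zero_le_one.trans h.one_le
    refine ⟨chartBall n x₀ R, nhdsWithin_le_nhds (chartBall_mem_nhds x₀ h.radius_pos),
      K.toNNReal * K.toNNReal, fun u C hu ↦ ?_⟩
    obtain ⟨V, hV, T, hT, hgrad⟩ := h.exists_lipschitz_repr hM.isClosed hu
    filter_upwards [ae_extChartAt_notMem hac x₀ hT] with x hx hxM hxs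
    obtain ⟨h1, h2⟩ := hgrad x hxM hxs.1 hxs.2 (hx hxs.1)
    refine ⟨h1, ?_⟩
    have h3 := h.norm_le_of_inner_frame hxs.1 hxs.2 h2
    have h4 : ‖fderiv ℝ V (extChartAt (𝓡 n) x₀ x)‖ ≤ (C * K.toNNReal : ℝ≥0) :=
      norm_fderiv_le_of_lipschitz ℝ hV
    have h5 : ‖grad n M u x‖ ≤ (C * (K.toNNReal * K.toNNReal) : ℝ≥0) := by
      refine h3.trans ((mul_le_mul_of_nonneg_left h4 hK).trans_eq ?_)
      simp only [NNReal.coe_mul, Real.coe_toNNReal _ hK]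
      ring
    rw [← ofReal_norm]
    refine (ENNReal.ofReal_le_ofReal h5).trans_eq ?_
    rw [ENNReal.ofReal_coe_nnreal, ENNReal.coe_mul]

/-- `grad` is a choice in varying fibres, so measurability is sought in a chart: the length is a
countable supremum of quotients of measurable functions of the coordinates. The chart carries `m` to
a measure absolutely continuous with respect to Lebesgue measure, so almost everywhere measurability
pulls back. -/
lemma aemeasurable_enorm_grad {M : Set N} (hM : IsCompact M) {m : Measure N}
    (hac : m ≪ riemannianVolume n N) {u : M → ℝ} {C : ℝ≥0} (hu : LipschitzWith C u) :
    AEMeasurable (fun x ↦ ‖grad n M u x‖ₑ) (m.restrict M) := by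
  suffices H : AEMeasurable (fun x ↦ ‖grad n M u x‖ₑ) (m.restrict (M ∩ M)) by
    rwa [inter_self] at H
  refine hM.induction_on
    (p := fun s ↦ AEMeasurable (fun x ↦ ‖grad n M u x‖ₑ) (m.restrict (s ∩ M))) ?_ ?_ ?_ ?_
  · simp
  · intro s t hst ht
    exact ht.mono_measure (Measure.restrict_mono (inter_subset_inter_left _ hst) le_rfl)
  · intro s t hs ht
    rw [union_inter_distrib_right]
    exact aemeasurable_union_iff.2 ⟨hs, ht⟩
  · intro x₀ _
    obtain ⟨R, K, h⟩ := exists_chartBound (n := n) x₀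
    refine ⟨chartBall n x₀ R, nhdsWithin_le_nhds (chartBall_mem_nhds x₀ h.radius_pos), ?_⟩
    obtain ⟨V, hV, T, hT, hgrad⟩ := h.exists_lipschitz_repr hM.isClosed hu
    set W := chartBall n x₀ R ∩ M with hW
    have hWm : MeasurableSet W := (isOpen_chartBall x₀ R).measurableSet.inter hM.measurableSet
    set μ := m.restrict W with hμ
    have he : AEMeasurable (extChartAt (𝓡 n) x₀) μ := by
      refine ContinuousOn.aemeasurable ?_ hWm
      refine (continuousOn_extChartAt (I := 𝓡 n) x₀).mono fun x hx ↦ ?_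
      rw [extChartAt_source]; exact hx.1.1
    have habs : Measure.map (extChartAt (𝓡 n) x₀) μ ≪
        volume.restrict (ball (extChartAt (𝓡 n) x₀ x₀) R) := by
      refine Measure.AbsolutelyContinuous.mk fun T' hT' hT0 ↦ ?_
      rw [Measure.restrict_apply hT'] at hT0
      rw [Measure.map_apply_of_aemeasurable he hT', hμ, Measure.restrict_apply' hWm]
      refine measure_mono_null ?_ (measure_chart_preimage_eq_zero hac x₀ hT0)
      rintro x ⟨hx1, hx2⟩
      exact ⟨hx2.1.1, hx1, hx2.1.2⟩
    have hg : AEMeasurable (fun z ↦ ⨆ k : ℕ, ENNReal.ofReal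
        (|fderiv ℝ V z (TopologicalSpace.denseSeq (EuclideanSpace ℝ (Fin n)) k)| /
          chartNorm n x₀ z (TopologicalSpace.denseSeq (EuclideanSpace ℝ (Fin n)) k)))
        (volume.restrict (ball (extChartAt (𝓡 n) x₀ x₀) R)) := by
      refine AEMeasurable.iSup fun k ↦ ENNReal.measurable_ofReal.comp_aemeasurable ?_
      refine AEMeasurable.div ?_ ((h.continuousOn _).aemeasurable measurableSet_ball)
      exact (measurable_fderiv_apply_const ℝ V _).abs.aemeasurable
    refine ((hg.mono_ac habs).comp_aemeasurable he).congr ?_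
    rw [Filter.EventuallyEq, hμ, ae_restrict_iff' hWm]
    filter_upwards [ae_extChartAt_notMem hac x₀ hT] with x hx hxW
    obtain ⟨-, h2⟩ := hgrad x hxW.2 hxW.1.1 hxW.1.2 (hx hxW.1.1)
    simp only [Function.comp]
    rw [enorm_eq_iSup_of_inner_frame hxW.1.1 h2]
    simp only [chartNorm_extChartAt hxW.1.1]

lemma isLipschitzH1_of_lipschitzWith {M : Set N} (hM : IsCompact M) {m : Measure N}
    [IsFiniteMeasure m] (hac : m ≪ riemannianVolume n N) {u : M → ℝ} {C : ℝ≥0}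
    (hu : LipschitzWith C u) : IsLipschitzH1 n m M u := by
  obtain ⟨B, hB⟩ := exists_grad_bound hM hac
  have hgr := hB u C hu
  refine ⟨⟨C, hu⟩, ?_, aemeasurable_enorm_grad hM hac hu, ?_⟩
  · rw [ae_restrict_iff' hM.measurableSet]
    exact hgr.mono fun x hx hxM ↦ (hx hxM).1
  · have : CompactSpace M := isCompact_iff_compactSpace.1 hM
    obtain ⟨A, hA⟩ := isCompact_univ.exists_bound_of_continuousOn hu.continuous.continuousOn
    have h1 : ∫⁻ x in M, ‖grad n M u x‖ₑ ^ 2 ∂m < ⊤ := by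
      refine lt_of_le_of_lt (setLIntegral_mono_ae' hM.measurableSet
        (g := fun _ ↦ ((C * B : ℝ≥0∞)) ^ 2) ?_) ?_
      · exact hgr.mono fun x hx hxM ↦ by gcongr; exact (hx hxM).2
      · rw [setLIntegral_const]
        exact ENNReal.mul_lt_top (by finiteness) (measure_lt_top _ _)
    have h2 : ∫⁻ x in M, ‖extendZero M u x‖ₑ ^ 2 ∂m < ⊤ := by
      refine lt_of_le_of_lt (setLIntegral_mono' hM.measurableSet
        (g := fun _ ↦ (ENNReal.ofReal A) ^ 2) ?_) ?_
      · intro x hx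
        rw [extendZero_of_mem u hx, ← ofReal_norm]
        gcongr
        exact hA _ (mem_univ _)
      · rw [setLIntegral_const]
        exact ENNReal.mul_lt_top (by finiteness) (measure_lt_top _ _)
    rw [h1Norm]
    exact ENNReal.rpow_lt_top_of_nonneg (by norm_num) (ENNReal.add_lt_top.2 ⟨h1, h2⟩).ne

end LipschitzH1

/-! ### Elementary properties of conjugation -/

section Conjugation

lemma abs_iInf_sub_iInf_le {ι : Type*} [Nonempty ι] {f g : ι → ℝ} (hf : BddBelow (range f))
    (hg : BddBelow (range g)) {c : ℝ} (h : ∀ i, |f i - g i| ≤ c) :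
    |(⨅ i, f i) - ⨅ i, g i| ≤ c := by
  have h1 : (⨅ i, f i) - c ≤ ⨅ i, g i := le_ciInf fun i ↦ by
    linarith [ciInf_le hf i, (abs_le.1 (h i)).2]
  have h2 : (⨅ i, g i) - c ≤ ⨅ i, f i := le_ciInf fun i ↦ by
    linarith [ciInf_le hg i, (abs_le.1 (h i)).1]
  rw [abs_le]
  constructor <;> linarith

variable {N : Type*} [MetricSpace N] {M : Set N}

lemma abs_sq_dist_sub_sq_dist_le {x x' y : N} {L : ℝ} (h : dist x y ≤ L) (h' : dist x' y ≤ L) :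
    |dist x y ^ 2 / 2 - dist x' y ^ 2 / 2| ≤ L * dist x x' := by
  have h1 : |dist x y - dist x' y| ≤ dist x x' := abs_dist_sub_le x x' y
  have h2 : dist x y ^ 2 / 2 - dist x' y ^ 2 / 2 =
      ((dist x y + dist x' y) / 2) * (dist x y - dist x' y) := by ring
  have h3 : 0 ≤ (dist x y + dist x' y) / 2 := by positivity
  rw [h2, abs_mul, abs_of_nonneg h3]
  exact mul_le_mul (by linarith) h1 (abs_nonneg _) (h3.trans (by linarith))

/-- The extension of the conjugate function to the ambient space. -/
def conjExt (M : Set N) (u : M → ℝ) (x : N) : ℝ :=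
  -⨅ y : M, ((dist x (y : N)) ^ 2 / 2 + u y)

lemma bddBelow_range_cost {u : M → ℝ} (hu : BddBelow (range u)) (x : N) :
    BddBelow (range fun y : M ↦ dist x (y : N) ^ 2 / 2 + u y) := by
  obtain ⟨b, hb⟩ := hu
  refine ⟨b, ?_⟩
  rintro _ ⟨y, rfl⟩
  have : b ≤ u y := hb ⟨y, rfl⟩
  have : 0 ≤ dist x (y : N) ^ 2 / 2 := by positivity
  linarith

lemma abs_conjExt_sub_conjExt_le [Nonempty M] {u v : M → ℝ} (hu : BddBelow (range u))
    (hv : BddBelow (range v)) {c : ℝ} (h : ∀ y, |u y - v y| ≤ c) (x : N) :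
    |conjExt M u x - conjExt M v x| ≤ c := by
  have := abs_iInf_sub_iInf_le (bddBelow_range_cost hu x) (bddBelow_range_cost hv x) (c := c)
    (fun y ↦ by simpa using h y)
  rw [conjExt, conjExt, neg_sub_neg, abs_sub_comm]
  exact this

lemma abs_conjExt_sub_le [Nonempty M] {u : M → ℝ} (hu : BddBelow (range u)) {x x' : N} {L : ℝ}
    (h : ∀ y ∈ M, dist x y ≤ L) (h' : ∀ y ∈ M, dist x' y ≤ L) :
    |conjExt M u x - conjExt M u x'| ≤ L * dist x x' := by
  have := abs_iInf_sub_iInf_le (bddBelow_range_cost hu x) (bddBelow_range_cost hu x')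
    (c := L * dist x x') (fun y ↦ by
      simpa using abs_sq_dist_sub_sq_dist_le (h y y.2) (h' y y.2))
  rw [conjExt, conjExt, neg_sub_neg, abs_sub_comm]
  exact this

lemma lipschitzWith_of_mem_convexFunctions (hM : IsCompact M) {φ : M → ℝ}
    (hφ : φ ∈ convexFunctions M) : LipschitzWith (diam M).toNNReal φ := by
  obtain ⟨ψ, hψ⟩ := hφ
  refine LipschitzWith.of_dist_le_mul fun x x' ↦ ?_
  have : Nonempty M := ⟨x⟩
  rw [Real.coe_toNNReal _ diam_nonneg]
  have h1 := abs_iInf_sub_iInf_le (hψ x).bddBelow (hψ x').bddBelow (c := diam M * dist x x')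
    (fun y ↦ by
      simpa [Subtype.dist_eq] using abs_sq_dist_sub_sq_dist_le (dist_le_diam_of_mem hM.isBounded x.2 y.2)
        (dist_le_diam_of_mem hM.isBounded x'.2 y.2))
  rw [(hψ x).ciInf_eq, (hψ x').ciInf_eq, neg_sub_neg] at h1
  rwa [Real.dist_eq, abs_sub_comm]

lemma bddBelow_range_of_mem_convexFunctions (hM : IsCompact M) {φ : M → ℝ}
    (hφ : φ ∈ convexFunctions M) : BddBelow (range φ) := by
  have : CompactSpace M := isCompact_iff_compactSpace.1 hM
  exact (isCompact_range (lipschitzWith_of_mem_convexFunctions hM hφ).continuous).bddBelow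

lemma conj_mem_convexFunctions [Nonempty M] {φ : M → ℝ} (hφ : BddBelow (range φ)) :
    conj M φ ∈ convexFunctions M := by
  refine ⟨φ, fun x ↦ ?_⟩
  rw [conj, neg_neg]
  exact isGLB_ciInf (bddBelow_range_cost hφ (x : N))

end Conjugation

/-! ### Convergence of the gradients of conjugates -/

section Convergence

variable {n : ℕ} {N : Type*} [MetricSpace N] [ChartedSpace (EuclideanSpace ℝ (Fin n)) N]
  [IsManifold (𝓡 n) ∞ N] [RiemannianBundle (fun x : N ↦ TangentSpace (𝓡 n) x)]
  [IsRiemannianManifold (𝓡 n) N] {M : Set N} [Nonempty M]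

/-- An almost minimizing `y` for the centre is a competitor at both `a + k` and `a - k`. The term `u
y` cancels, so the constants do not depend on `u`. -/
lemma ChartBound.exists_secondDiffGE_conjExt {x₀ : N} {R K : ℝ} (h : ChartBound (n := n) x₀ R K)
    (hM : IsCompact M) :
    ∃ r > 0, r ≤ R ∧ ∃ s₀ > 0, ∃ C ≥ 0, ∀ u : M → ℝ, BddBelow (range u) →
      SecondDiffGE (conjExt M u ∘ (extChartAt (𝓡 n) x₀).symm) (extChartAt (𝓡 n) x₀ x₀) r s₀ C := by
  obtain ⟨D, hD⟩ := hM.isBounded.subset_closedBall x₀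
  obtain ⟨r, hr, hrR, s₀, hs₀, C, hC, H⟩ := h.exists_secondDiff_le D
  refine ⟨r, hr, hrR, s₀, hs₀, C, hC, fun u hu a k s hs hs' hk ha hak hak' ↦ ?_⟩
  simp only [Function.comp]
  refine le_of_forall_pos_le_add fun ε hε ↦ ?_
  obtain ⟨y, hy⟩ := exists_lt_of_ciInf_lt (lt_add_of_pos_right
    (⨅ y : M, (dist ((extChartAt (𝓡 n) x₀).symm a) (y : N) ^ 2 / 2 + u y)) (half_pos hε))
  have h1 := ciInf_le (bddBelow_range_cost hu ((extChartAt (𝓡 n) x₀).symm (a + k))) y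
  have h2 := ciInf_le (bddBelow_range_cost hu ((extChartAt (𝓡 n) x₀).symm (a - k))) y
  have h3 := H y (by rw [dist_comm]; exact hD y.2) a k s hs hs' hk ha hak hak'
  have h4 : 0 ≤ C * s ^ 4 := by positivity
  simp only [conjExt]
  linarith

lemma ChartBound.exists_lipschitzOnWith_conjExt {x₀ : N} {R K : ℝ}
    (h : ChartBound (n := n) x₀ R K) (hM : IsCompact M) :
    ∃ L : ℝ≥0, ∀ u : M → ℝ, BddBelow (range u) →
      LipschitzOnWith L (conjExt M u ∘ (extChartAt (𝓡 n) x₀).symm)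
        (ball (extChartAt (𝓡 n) x₀ x₀) R) := by
  obtain ⟨D, hD⟩ := hM.isBounded.subset_closedBall x₀
  have hK := h.one_le
  have hR := h.radius_pos
  have hD0 : 0 ≤ D := by
    obtain ⟨y⟩ := ‹Nonempty M›
    exact dist_nonneg.trans (hD y.2)
  have hdist : ∀ z ∈ ball (extChartAt (𝓡 n) x₀ x₀) R, ∀ y ∈ M,
      dist ((extChartAt (𝓡 n) x₀).symm z) y ≤ K * R + D := by
    intro z hz y hy
    have h1 := h.dist_symm_le_norm hz (mem_ball_self hR)
    rw [extChartAt_to_inv, norm_sub_rev, ← dist_eq_norm] at h1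
    have h2 : K * dist z (extChartAt (𝓡 n) x₀ x₀) ≤ K * R := by
      gcongr
      exact (mem_ball.1 hz).le
    have h3 : dist x₀ y ≤ D := by rw [dist_comm]; exact hD hy
    linarith [dist_triangle ((extChartAt (𝓡 n) x₀).symm z) x₀ y]
  have hL0 : 0 ≤ (K * R + D) * K := by positivity
  refine ⟨((K * R + D) * K).toNNReal, fun u hu ↦
    LipschitzOnWith.of_dist_le_mul fun z hz z' hz' ↦ ?_⟩
  rw [Real.coe_toNNReal _ hL0, Real.dist_eq, mul_assoc]
  refine (abs_conjExt_sub_le hu (hdist z hz) (hdist z' hz')).trans ?_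
  refine mul_le_mul_of_nonneg_left ?_ (by positivity)
  rw [dist_comm z, dist_eq_norm]
  exact h.dist_symm_le_norm hz hz'

variable [IsContMDiffRiemannianBundle (𝓡 n) ∞ (EuclideanSpace ℝ (Fin n))
      (fun x : N ↦ TangentSpace (𝓡 n) x)] [MeasurableSpace N] [BorelSpace N]

/-- Uniform convergence implies the convergence almost everywhere of the gradients of the
conjugates. -/
lemma ae_tendsto_grad_conj_sub (hM : IsCompact M) {m : Measure N}
    (hac : m ≪ riemannianVolume n N) {u : ℕ → M → ℝ} {v : M → ℝ}
    (hu : ∀ k, BddBelow (range (u k))) (hv : BddBelow (range v)) {ε : ℕ → ℝ}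
    (hε : ∀ k y, |u k y - v y| ≤ ε k) (hε0 : Tendsto ε atTop (𝓝 0)) :
    ∀ᵐ x ∂m, x ∈ M → Tendsto (fun k ↦ ‖grad n M (conj M (u k) - conj M v) x‖) atTop (𝓝 0) := by
  suffices H : ∀ᵐ x ∂m, x ∈ M → x ∈ M →
      Tendsto (fun k ↦ ‖grad n M (conj M (u k) - conj M v) x‖) atTop (𝓝 0) from
    H.mono fun x hx hxM ↦ hx hxM hxM
  refine hM.induction_on (p := fun s ↦ ∀ᵐ x ∂m, x ∈ M → x ∈ s →
      Tendsto (fun k ↦ ‖grad n M (conj M (u k) - conj M v) x‖) atTop (𝓝 0)) ?_ ?_ ?_ ?_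
  · exact ae_of_all _ fun x _ hx ↦ absurd hx (notMem_empty x)
  · exact fun s t hst ht ↦ ht.mono fun x hx hxM hxs ↦ hx hxM (hst hxs)
  · intro s t hs ht
    filter_upwards [hs, ht] with x hx hx' hxM hxst
    exact hxst.elim (hx hxM) (hx' hxM)
  intro x₀ _
  obtain ⟨R, K, h⟩ := exists_chartBound (n := n) x₀
  obtain ⟨r, hr, hrR, s₀, hs₀, C, hC, hsd⟩ := h.exists_secondDiffGE_conjExt hM
  obtain ⟨L, hL⟩ := h.exists_lipschitzOnWith_conjExt hM
  refine ⟨chartBall n x₀ r, nhdsWithin_le_nhds (chartBall_mem_nhds x₀ hr), ?_⟩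
  have hdiff : ∀ w : M → ℝ, BddBelow (range w) → ∀ᵐ x ∂m, x ∈ chartBall n x₀ r →
      DifferentiableAt ℝ (conjExt M w ∘ (extChartAt (𝓡 n) x₀).symm) (extChartAt (𝓡 n) x₀ x) := by
    intro w hw
    have h1 := ae_iff.1 ((hL w hw).ae_differentiableWithinAt_of_mem (μ := volume))
    filter_upwards [ae_extChartAt_notMem hac x₀ h1] with x hx hxr
    have hxR : extChartAt (𝓡 n) x₀ x ∈ ball (extChartAt (𝓡 n) x₀ x₀) R :=
      ball_subset_ball hrR hxr.2
    have h2 := hx hxr.1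
    simp only [not_not] at h2
    exact (h2 hxR).differentiableAt (isOpen_ball.mem_nhds hxR)
  obtain ⟨T, hT, hTu⟩ := exists_null_uniqueDiffWithinAt n hM.isClosed x₀
  filter_upwards [ae_all_iff.2 fun k ↦ hdiff (u k) (hu k), hdiff v hv,
    ae_extChartAt_notMem hac x₀ hT] with x hxk hxv hxT hxM hxr
  have hxR : extChartAt (𝓡 n) x₀ x ∈ ball (extChartAt (𝓡 n) x₀ x₀) R :=
    ball_subset_ball hrR hxr.2
  -- The extended conjugates live on the whole chart ball, so second differences and derivatives may
  -- use points outside `M`.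
  have hconv := tendsto_fderiv_of_secondDiffGE hC hs₀ (fun k ↦ hsd (u k) (hu k))
    (fun k ↦ (hxk k hxr).hasFDerivAt) (hxv hxr).hasFDerivAt hxr.2
    (fun k z _ ↦ abs_conjExt_sub_conjExt_le (hu k) hv (hε k) _) hε0
  have hbound : ∀ k, ‖grad n M (conj M (u k) - conj M v) x‖ ≤
      K * ‖fderiv ℝ (conjExt M (u k) ∘ (extChartAt (𝓡 n) x₀).symm) (extChartAt (𝓡 n) x₀ x) -
        fderiv ℝ (conjExt M v ∘ (extChartAt (𝓡 n) x₀).symm) (extChartAt (𝓡 n) x₀ x)‖ := by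
    intro k
    refine h.norm_le_of_inner_frame hxr.1 hxR (hasGradAt_and_inner_grad hxM hxr.1
      ((hxk k hxr).hasFDerivAt.sub (hxv hxr).hasFDerivAt) ?_ (hTu x hxM hxr.1 (hxT hxr.1))).2
    filter_upwards [self_mem_nhdsWithin, nhdsWithin_le_nhds
      ((chartAt (EuclideanSpace ℝ (Fin n)) x₀).open_source.mem_nhds hxr.1)] with y hyM hys
    have hleft : (extChartAt (𝓡 n) x₀).symm (extChartAt (𝓡 n) x₀ y) = y :=
      (extChartAt (𝓡 n) x₀).left_inv (by simpa using hys)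
    rw [extendZero_of_mem _ hyM, Pi.sub_apply, Pi.sub_apply, Function.comp_apply,
      Function.comp_apply, hleft]
    rfl
  refine squeeze_zero (fun _ ↦ norm_nonneg _) hbound ?_
  have h1 := (tendsto_iff_norm_sub_tendsto_zero.1 hconv).const_mul K
  rwa [mul_zero] at h1

end Convergence

/-! ### From `H¹` smallness to uniform smallness -/

section UniformConvergence

variable {N : Type*} [MetricSpace N] [MeasurableSpace N] {M : Set N} {m : Measure N}

/-- Finitely many balls of radius `ρ / 2` centred in `M` cover `M`, have positive mass, and each is
contained in the ball of radius `ρ` around any of its points. -/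
lemma exists_pos_le_measure_ball (hM : IsCompact M) (hsupp : M ⊆ m.support) {ρ : ℝ} (hρ : 0 < ρ) :
    ∃ κ : ℝ≥0∞, 0 < κ ∧ ∀ x ∈ M, κ ≤ m (ball x ρ) := by
  suffices H : ∃ κ : ℝ≥0∞, 0 < κ ∧ ∀ x ∈ M, x ∈ M → κ ≤ m (ball x ρ) by
    obtain ⟨κ, hκ, h⟩ := H
    exact ⟨κ, hκ, fun x hx ↦ h x hx hx⟩
  refine hM.induction_on (p := fun s ↦ ∃ κ : ℝ≥0∞, 0 < κ ∧ ∀ x ∈ s, x ∈ M → κ ≤ m (ball x ρ))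
    ⟨1, one_pos, fun x hx ↦ absurd hx (notMem_empty x)⟩ ?_ ?_ ?_
  · rintro s t hst ⟨κ, hκ, h⟩
    exact ⟨κ, hκ, fun x hx ↦ h x (hst hx)⟩
  · rintro s t ⟨κ, hκ, h⟩ ⟨κ', hκ', h'⟩
    refine ⟨min κ κ', lt_min hκ hκ', fun x hx hxM ↦ ?_⟩
    rcases hx with hx | hx
    · exact (min_le_left _ _).trans (h x hx hxM)
    · exact (min_le_right _ _).trans (h' x hx hxM)
  · intro x₀ hx₀
    refine ⟨ball x₀ (ρ / 2), nhdsWithin_le_nhds (ball_mem_nhds _ (half_pos hρ)),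
      m (ball x₀ (ρ / 2)),
      (Measure.mem_support_iff_forall x₀).1 (hsupp hx₀) _ (ball_mem_nhds _ (half_pos hρ)), ?_⟩
    intro x hx _
    refine measure_mono fun y hy ↦ ?_
    rw [mem_ball] at hx hy ⊢
    rw [dist_comm] at hx
    linarith [dist_triangle y x₀ x]

variable [BorelSpace N] {n : ℕ} [ChartedSpace (EuclideanSpace ℝ (Fin n)) N]
  [RiemannianBundle (fun x : N ↦ TangentSpace (𝓡 n) x)]

variable (n) in
/-- For functions with a given Lipschitz constant, smallness in `H¹` implies uniform smallness. -/
lemma exists_forall_abs_le_of_h1Norm_lt (hM : IsCompact M) (hsupp : M ⊆ m.support)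
    (hnull : m Mᶜ = 0) (C : ℝ≥0) {η : ℝ} (hη : 0 < η) :
    ∃ δ : ℝ≥0∞, 0 < δ ∧ ∀ w : M → ℝ, LipschitzWith C w → h1Norm n m M w < δ → ∀ x, |w x| ≤ η := by
  -- On a ball of this radius a `C`-Lipschitz function varies by at most `η / 2`, so it stays above
  -- `η / 2` in absolute value if it exceeds `η` at the centre; `C + 1` avoids division by zero.
  have hρ : 0 < η / (2 * (C + 1)) := by positivity
  obtain ⟨κ, hκ, hball⟩ := exists_pos_le_measure_ball hM hsupp hρ
  have hη2 : 0 < ENNReal.ofReal (η / 2) := ENNReal.ofReal_pos.2 (half_pos hη)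
  refine ⟨(ENNReal.ofReal (η / 2) ^ 2 * κ) ^ (1 / 2 : ℝ),
    ENNReal.rpow_pos_of_nonneg (ENNReal.mul_pos (ENNReal.pow_pos hη2 2).ne' hκ.ne') (by norm_num),
    fun w hw hlt x ↦ ?_⟩
  by_contra! hx
  refine absurd hlt (not_lt.2 ?_)
  rw [h1Norm]
  refine ENNReal.rpow_le_rpow (le_trans ?_ le_add_self) (by norm_num)
  have hrestr : m.restrict M = m := Measure.restrict_eq_self_of_ae_mem
    (measure_eq_zero_iff_ae_notMem.1 hnull |>.mono fun y hy ↦ not_not.1 hy)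
  have hlow : ∀ y ∈ ball (x : N) (η / (2 * (C + 1))) ∩ M,
      ENNReal.ofReal (η / 2) ≤ ‖extendZero M w y‖ₑ := by
    rintro y ⟨hy, hyM⟩
    rw [extendZero_of_mem w hyM, ← ofReal_norm]
    refine ENNReal.ofReal_le_ofReal ?_
    have h1 := hw.dist_le_mul x ⟨y, hyM⟩
    rw [Real.dist_eq, Subtype.dist_eq] at h1
    have h2 : dist (x : N) y < η / (2 * (C + 1)) := by rw [dist_comm]; exact hy
    have h3 : (C : ℝ) * dist (x : N) y ≤ η / 2 := by
      have h4 : ((C : ℝ) + 1) * dist (x : N) y ≤ η / 2 := by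
        rw [lt_div_iff₀ (by positivity)] at h2
        linarith
      have h5 : 0 ≤ dist (x : N) y := dist_nonneg
      linarith
    have h4 := abs_sub_abs_le_abs_sub (w x) (w ⟨y, hyM⟩)
    rw [Real.norm_eq_abs]
    simp only at h1
    linarith
  have hmeas : MeasurableSet (ball (x : N) (η / (2 * (C + 1))) ∩ M) :=
    measurableSet_ball.inter hM.measurableSet
  calc ENNReal.ofReal (η / 2) ^ 2 * κ
      ≤ ENNReal.ofReal (η / 2) ^ 2 * m (ball (x : N) (η / (2 * (C + 1))) ∩ M) := by
        gcongr
        rw [← Measure.restrict_apply measurableSet_ball, hrestr]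
        exact hball x x.2
    _ = ∫⁻ _ in ball (x : N) (η / (2 * (C + 1))) ∩ M, ENNReal.ofReal (η / 2) ^ 2 ∂m := by
        rw [setLIntegral_const]
    _ ≤ ∫⁻ y in ball (x : N) (η / (2 * (C + 1))) ∩ M, ‖extendZero M w y‖ₑ ^ 2 ∂m :=
        setLIntegral_mono' hmeas fun y hy ↦ by gcongr; exact hlow y hy
    _ ≤ _ := lintegral_mono_set inter_subset_right

end UniformConvergence

/-! ### Continuity of conjugation -/

section Continuity

variable {n : ℕ} {N : Type*} [MetricSpace N] [ChartedSpace (EuclideanSpace ℝ (Fin n)) N]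
  [IsManifold (𝓡 n) ∞ N] [RiemannianBundle (fun x : N ↦ TangentSpace (𝓡 n) x)]
  [IsContMDiffRiemannianBundle (𝓡 n) ∞ (EuclideanSpace ℝ (Fin n))
      (fun x : N ↦ TangentSpace (𝓡 n) x)]
  [IsRiemannianManifold (𝓡 n) N] [MeasurableSpace N] [BorelSpace N] {M : Set N} [Nonempty M]
  {m : Measure N} [IsFiniteMeasure m]

lemma tendsto_h1Norm_conj_sub (hM : IsCompact M) (hsupp : M ⊆ m.support) (hnull : m Mᶜ = 0)
    (hac : m ≪ riemannianVolume n N) {φ : M → ℝ} (hφ : φ ∈ convexFunctions M) {ψ : ℕ → M → ℝ}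
    (hψ : ∀ k, ψ k ∈ convexFunctions M)
    (hlim : Tendsto (fun k ↦ h1Norm n m M (ψ k - φ)) atTop (𝓝 0)) :
    Tendsto (fun k ↦ h1Norm n m M (conj M (ψ k) - conj M φ)) atTop (𝓝 0) := by
  have : CompactSpace M := isCompact_iff_compactSpace.1 hM
  set C := (diam M).toNNReal + (diam M).toNNReal with hC
  have hφb := bddBelow_range_of_mem_convexFunctions hM hφ
  have hψb := fun k ↦ bddBelow_range_of_mem_convexFunctions hM (hψ k)
  have hlip : ∀ k, LipschitzWith C (ψ k - φ) := fun k ↦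
    (lipschitzWith_of_mem_convexFunctions hM (hψ k)).sub
      (lipschitzWith_of_mem_convexFunctions hM hφ)
  have hlip' : ∀ k, LipschitzWith C (conj M (ψ k) - conj M φ) := fun k ↦
    (lipschitzWith_of_mem_convexFunctions hM (conj_mem_convexFunctions (hψb k))).sub
      (lipschitzWith_of_mem_convexFunctions hM (conj_mem_convexFunctions hφb))
  set ε : ℕ → ℝ := fun k ↦ ⨆ y, |(ψ k - φ) y| with hεdef
  have hε : ∀ k y, |ψ k y - φ y| ≤ ε k := fun k y ↦
    le_ciSup (isCompact_range (hlip k).continuous.abs).bddAbove y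
  have hε_nonneg : ∀ k, 0 ≤ ε k := fun k ↦ Real.iSup_nonneg fun y ↦ abs_nonneg _
  have hε0 : Tendsto ε atTop (𝓝 0) := by
    rw [Metric.tendsto_atTop']
    intro η hη
    obtain ⟨δ, hδ, h⟩ := exists_forall_abs_le_of_h1Norm_lt n hM hsupp hnull C (half_pos hη)
    obtain ⟨k₀, hk₀⟩ := eventually_atTop.1 (hlim.eventually_lt_const hδ)
    refine ⟨k₀, fun k hk ↦ ?_⟩
    rw [Real.dist_0_eq_abs, abs_of_nonneg (hε_nonneg k)]
    exact (ciSup_le fun y ↦ h _ (hlip k) (hk₀ k hk.le) y).trans_lt (half_lt_self hη)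
  have hgrad := ae_tendsto_grad_conj_sub hM hac hψb hφb hε hε0
  obtain ⟨B, hB⟩ := exists_grad_bound hM hac
  -- Dominated convergence: the differences of conjugates share the Lipschitz constant `C`, so their
  -- gradients are bounded by `C * B` almost everywhere on `M`, and `m` is finite.
  have hI₁ : Tendsto (fun k ↦ ∫⁻ x in M, ‖grad n M (conj M (ψ k) - conj M φ) x‖ₑ ^ 2 ∂m) atTop
      (𝓝 0) := by
    have h1 := tendsto_lintegral_of_dominated_convergence' (μ := m.restrict M)
      (F := fun k x ↦ ‖grad n M (conj M (ψ k) - conj M φ) x‖ₑ ^ 2) (f := fun _ ↦ 0)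
      (fun _ ↦ (C * B : ℝ≥0∞) ^ 2)
      (fun k ↦ (aemeasurable_enorm_grad hM hac (hlip' k)).pow_const 2)
      (fun k ↦ by
        refine (ae_restrict_iff' hM.measurableSet).2 ((hB _ C (hlip' k)).mono fun x hx hxM ↦ ?_)
        dsimp only
        gcongr
        exact (hx hxM).2)
      (by
        rw [setLIntegral_const]
        exact ENNReal.mul_ne_top (by finiteness) (measure_ne_top _ _))
      (by
        refine (ae_restrict_iff' hM.measurableSet).2 (hgrad.mono fun x hx hxM ↦ ?_)
        have h2 := ENNReal.tendsto_ofReal (hx hxM)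
        simp only [ofReal_norm, ENNReal.ofReal_zero] at h2
        simpa using ENNReal.Tendsto.pow (n := 2) h2)
    simpa using h1
  -- The zeroth-order part needs only that conjugation is nonexpansive for the sup norm.
  have hI₂ : Tendsto (fun k ↦ ∫⁻ x in M, ‖extendZero M (conj M (ψ k) - conj M φ) x‖ₑ ^ 2 ∂m)
      atTop (𝓝 0) := by
    have h1 : ∀ k, ∫⁻ x in M, ‖extendZero M (conj M (ψ k) - conj M φ) x‖ₑ ^ 2 ∂m ≤
        ENNReal.ofReal (ε k) ^ 2 * m M := by
      intro k
      rw [← setLIntegral_const]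
      refine setLIntegral_mono' hM.measurableSet fun x hx ↦ ?_
      rw [extendZero_of_mem _ hx, ← ofReal_norm]
      gcongr
      exact abs_conjExt_sub_conjExt_le (hψb k) hφb (hε k) x
    have h2 : Tendsto (fun k ↦ ENNReal.ofReal (ε k) ^ 2 * m M) atTop (𝓝 0) := by
      have h3 := ENNReal.Tendsto.pow (n := 2) (ENNReal.tendsto_ofReal hε0)
      have h4 := ENNReal.Tendsto.mul_const (b := m M) h3 (Or.inr (measure_ne_top _ _))
      simpa using h4
    exact tendsto_of_tendsto_of_tendsto_of_le_of_le tendsto_const_nhds h2 (fun _ ↦ bot_le) h1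
  have h := (hI₁.add hI₂).ennrpow_const (1 / 2 : ℝ)
  simpa [h1Norm] using h

end Continuity

end ConjugationMap

end

open ConjugationMap in
theorem lemma3p5 {n : ℕ} {N : Type*} [MetricSpace N] [CompleteSpace N]
    [SecondCountableTopology N]
    [ChartedSpace (EuclideanSpace ℝ (Fin n)) N] [IsManifold (𝓡 n) ∞ N]
    [RiemannianBundle (fun x : N ↦ TangentSpace (𝓡 n) x)]
    [IsContMDiffRiemannianBundle (𝓡 n) ∞ (EuclideanSpace ℝ (Fin n))
      (fun x : N ↦ TangentSpace (𝓡 n) x)]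
    [IsRiemannianManifold (𝓡 n) N]
    [MeasurableSpace N] [BorelSpace N]
    (M : Set N) (hM : IsCompact M)
    (m : Measure N) [IsProbabilityMeasure m] (hsupp : m.support = M)
    (hac : m ≪ riemannianVolume n N) :
    (∀ φ ∈ convexFunctions M, conj M φ ∈ convexFunctions M) ∧
    (∀ φ ∈ convexFunctions M, IsLipschitzH1 n m M φ) ∧
    (∀ φ ∈ convexFunctions M, ∀ ε : ℝ≥0∞, 0 < ε → ∃ δ : ℝ≥0∞, 0 < δ ∧
      ∀ ψ ∈ convexFunctions M, h1Norm n m M (ψ - φ) < δ →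
        h1Norm n m M (conj M ψ - conj M φ) < ε) := by
  have hne : Nonempty M := by
    rw [← hsupp]
    exact (Measure.nonempty_support (IsProbabilityMeasure.ne_zero m)).to_subtype
  have hnull : m Mᶜ = 0 := by
    rw [← hsupp]
    exact Measure.measure_compl_support
  refine ⟨fun φ hφ ↦ conj_mem_convexFunctions (bddBelow_range_of_mem_convexFunctions hM hφ),
    fun φ hφ ↦ isLipschitzH1_of_lipschitzWith hM hac (lipschitzWith_of_mem_convexFunctions hM hφ),
    fun φ hφ ε hε ↦ ?_⟩
  -- Sequential continuity suffices: a failure of continuity at `φ` yields a sequence with `H¹`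
  -- distance to `φ` below `1 / (k + 1)`.
  by_contra! H
  have hpos : ∀ k : ℕ, (0 : ℝ≥0∞) < ((k : ℝ≥0∞) + 1)⁻¹ := fun k ↦
    ENNReal.inv_pos.2 (by finiteness)
  choose ψ hψ hψlt hψge using fun k : ℕ ↦ H _ (hpos k)
  have hδ : Filter.Tendsto (fun k : ℕ ↦ ((k : ℝ≥0∞) + 1)⁻¹) Filter.atTop (nhds 0) := by
    have := (Filter.tendsto_add_atTop_iff_nat 1).2 ENNReal.tendsto_inv_nat_nhds_zero
    simpa using this
  have hlim := tendsto_of_tendsto_of_tendsto_of_le_of_le tendsto_const_nhds hδ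
    (fun _ ↦ bot_le) (fun k ↦ (hψlt k).le)
  have hconv := tendsto_h1Norm_conj_sub hM hsupp.ge hnull hac hφ hψ hlim
  obtain ⟨k, hk⟩ := (hconv.eventually_lt_const hε).exists
  exact absurd hk (not_lt.2 (hψge k))
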